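/- Let $V$ be an infinite countable set, let $m : V \to (0,\infty)$, and let $b : V\times V \to [0,\infty)$ satisfy $b(x,x)=0$, $b(x,y)=b(y,x)$ and $\sum_{y\in V} b(x,y)<\infty$ for all $x,y\in V$. Assume that $(b,0)$ is connected, i.e. any two $x,y \in V$ are joined by a finite sequence $x=x_0,\dots,x_n=y$ in $V$ with $b(x_{j-1},x_j)>0$ for $j = 1,\dots,n$. For $u : V\to\mathbb{R}$ put $\widetilde Q(u)=\frac12\sum_{x,y\in V} b(x,y)(u(x)-u(y))^2\in[0,\infty]$ and let $\widetilde D=\{u : \widetilde Q(u)<\infty\}$, on which $\widetilde Q$ also denotes the bilinear form $\widetilde Q(u,v)=\frac12\sum_{x,y\in V} b(x,y)(u(x)-u(y))(v(x)-v(y))$. Let $\ell^2(V,m)$ be the Hilbert space of all real functions $u$ on $V$ with $\|u\|_2^2=\sum_{x\in V} u(x)^2m(x)<\infty$. The Neumann form $Q^N$ is the restriction of $\widetilde Q$ to $D(Q^N)=\widetilde D\cap \ell^2(V,m)$. The regular form $Q^D$ is the restriction of $\widetilde Q$ to $D(Q^D)$, the closure in $D(Q^N)$ of the space of finitely supported functions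 with respect to the norm $(\widetilde Q(u)+\|u\|_2^2)^{1/2}$. Let $L$ be the nonnegative self-adjoint operator on $\ell^2(V,m)$ associated with $Q^D$: its domain consists of all $u\in D(Q^D)$ for which there is $w\in\ell^2(V,m)$ with $Q^D(u,v)=\langle w,v\rangle$ for all $v\in D(Q^D)$, and then $Lu=w$. Let $e^{-tL}$, $t \ge 0$, be the strongly continuous semigroup generated by $-L$. For bounded $u\ge 0$ the resolvent is extended by $(L+1)^{-1}u=\lim_{n\to\infty}(L+1)^{-1}f_n$ (pointwise), where $f_n\in\ell^2(V,m)$ are nonnegative and increase pointwise to $u$; the limit does not depend on the choice of $(f_n)$. Suppose that $Q^D$ is recurrent, i.e. $\int_0^\infty (e^{-tL}\delta_x)(y)\,dt=\infty$ for all $x,y\in V$, where $\delta_x$ is the function with value $1$ at $x$ and $0$ elsewhere. Then $Q^D$ is stochastically complete, i.e. $(L+1)^{-1}1=1$, and $Q^D=Q^N$. -/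

import Mathlib

open Filter Topology MeasureTheory

noncomputable section

/-! ### Weighted graphs and measures of full support -/

/-- A weighted graph `(b, c)` over the vertex set `V`. -/
structure WeightedGraph (V : Type*) where
  b : V → V → ℝ
  c : V → ℝ
  b_nonneg : ∀ x y, 0 ≤ b x y
  b_self : ∀ x, b x x = 0
  b_symm : ∀ x y, b x y = b y x
  b_summable : ∀ x, Summable (b x)
  c_nonneg : ∀ x, 0 ≤ c x

/-- A measure of full support on the discrete set `V`, given by its strictly positive weights. -/
structure VertexMeasure (V : Type*) where
  weight : V → ℝ
  pos : ∀ x, 0 < weight x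

variable {V : Type*}

/-- `(b, c)` is connected: any two vertices are joined by a path along edges of positive weight. -/
def WeightedGraph.IsConnected (G : WeightedGraph V) : Prop :=
  ∀ x y, Relation.ReflTransGen (fun v w => 0 < G.b v w) x y

/-! ### The Hilbert space `ℓ²(V, m)` -/

theorem VertexMeasure.summable_mul (m : VertexMeasure V) {u v : V → ℝ}
    (hu : Summable fun x => u x ^ 2 * m.weight x) (hv : Summable fun x => v x ^ 2 * m.weight x) :
    Summable fun x => u x * v x * m.weight x := by
  refine Summable.of_norm_bounded (hu.add hv) fun x => ?_
  have hm := (m.pos x).le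
  rw [Real.norm_eq_abs, abs_mul, abs_of_nonneg hm, ← add_mul]
  refine mul_le_mul_of_nonneg_right ?_ hm
  rw [abs_mul]
  nlinarith [sq_nonneg (|u x| - |v x|), sq_abs (u x), sq_abs (v x), sq_nonneg (u x),
    sq_nonneg (v x)]

/-- The subspace of functions `u : V → ℝ` with `∑ u(x)² m(x) < ∞`. -/
def ell2Submodule (m : VertexMeasure V) : Submodule ℝ (V → ℝ) where
  carrier := {u | Summable fun x => u x ^ 2 * m.weight x}
  add_mem' {u v} hu hv := by
    have h := (hu.add hv).add ((m.summable_mul hu hv).mul_left 2)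
    refine h.congr fun x => ?_
    simp only [Pi.add_apply]
    ring
  zero_mem' := by simp [summable_zero]
  smul_mem' a u hu := by
    refine (hu.mul_left (a ^ 2)).congr fun x => ?_
    simp only [Pi.smul_apply, smul_eq_mul]
    ring

/-- The space `ℓ²(V, m)`. This is a separate type so that it carries the `ℓ²`-norm and not the
topology of pointwise convergence. -/
def Ell2 (m : VertexMeasure V) : Type _ := ell2Submodule m

namespace Ell2

variable {m : VertexMeasure V}

instance : AddCommGroup (Ell2 m) := inferInstanceAs (AddCommGroup (ell2Submodule m))

instance : Module ℝ (Ell2 m) := inferInstanceAs (Module ℝ (ell2Submodule m))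

/-- The inclusion of `ℓ²(V, m)` into the space of all functions. -/
def toFun : Ell2 m →ₗ[ℝ] (V → ℝ) := (ell2Submodule m).subtype

instance : CoeFun (Ell2 m) (fun _ => V → ℝ) := ⟨fun u => toFun u⟩

/-- A square summable function as an element of `ℓ²(V, m)`. -/
def mk (u : V → ℝ) (hu : Summable fun x => u x ^ 2 * m.weight x) : Ell2 m := ⟨u, hu⟩

@[simp] theorem mk_apply (u : V → ℝ) (hu : Summable fun x => u x ^ 2 * m.weight x) (x : V) :
    (mk u hu : Ell2 m) x = u x := rfl

theorem summable (u : Ell2 m) : Summable fun x => u x ^ 2 * m.weight x := u.2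

@[ext] theorem ext {u v : Ell2 m} (h : ∀ x, u x = v x) : u = v := Subtype.ext (funext h)

/-- The inner product `⟨u, v⟩ = ∑ u(x) v(x) m(x)`. -/
abbrev core : InnerProductSpace.Core ℝ (Ell2 m) where
  inner u v := ∑' x, u x * v x * m.weight x
  conj_inner_symm u v := by
    simp only [conj_trivial]
    exact tsum_congr fun x => by ring
  re_inner_nonneg u := by
    simp only [RCLike.re_to_real]
    exact tsum_nonneg fun x => mul_nonneg (mul_self_nonneg _) (m.pos x).le
  add_left u v w := by
    rw [← (m.summable_mul u.summable w.summable).tsum_add (m.summable_mul v.summable w.summable)]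
    exact tsum_congr fun x => by simp only [map_add, Pi.add_apply]; ring
  smul_left u v r := by
    simp only [conj_trivial]
    rw [← tsum_mul_left]
    exact tsum_congr fun x => by simp only [map_smul, Pi.smul_apply, smul_eq_mul]; ring
  definite u hu := by
    have h0 : ∀ x, 0 ≤ u x * u x * m.weight x :=
      fun x => mul_nonneg (mul_self_nonneg _) (m.pos x).le
    have h1 := ((m.summable_mul u.summable u.summable).hasSum_iff.2 hu)
    have h2 := (hasSum_zero_iff_of_nonneg h0).1 h1
    ext x
    have h3 : u x * u x * m.weight x = 0 := congrFun h2 x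
    simpa [(m.pos x).ne'] using h3

instance : NormedAddCommGroup (Ell2 m) := (core (m := m)).toNormedAddCommGroup

instance : InnerProductSpace ℝ (Ell2 m) := InnerProductSpace.ofCore (core (m := m)).toCore

theorem inner_eq (u v : Ell2 m) : inner ℝ u v = ∑' x, u x * v x * m.weight x := rfl

instance : CompleteSpace (Ell2 m) := by
  let e : Ell2 m →ₗ[ℝ] lp (fun _ : V => ℝ) 2 :=
    { toFun := fun u => ⟨fun x => √(m.weight x) * u x, by
        apply memℓp_gen
        refine u.summable.congr fun x => ?_
        simp [mul_pow, Real.sq_sqrt (m.pos x).le, mul_comm]⟩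
      map_add' := fun u v => by ext x; exact mul_add _ _ _
      map_smul' := fun a u => by ext x; simp; ring }
  have hn : ∀ u, ‖e u‖ = ‖u‖ := by
    intro u
    have h1 : ‖e u‖^2 = ‖u‖^2 := by
      rw [← real_inner_self_eq_norm_sq, ← real_inner_self_eq_norm_sq, Ell2.inner_eq,
        lp.inner_eq_tsum]
      refine tsum_congr fun x => ?_
      simp only [e, LinearMap.coe_mk, AddHom.coe_mk, RCLike.inner_apply, conj_trivial]
      have := Real.mul_self_sqrt (m.pos x).le
      linear_combination (u x)^2 * this
    exact (pow_left_inj₀ (norm_nonneg _) (norm_nonneg _) two_ne_zero).1 h1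
  let L : Ell2 m →ₗᵢ[ℝ] lp (fun _ : V => ℝ) 2 := ⟨e, hn⟩
  have hs : Function.Surjective L := by
    intro g
    refine ⟨Ell2.mk (fun x => g x / √(m.weight x)) ?_, ?_⟩
    · have := (memℓp_gen_iff (by norm_num)).1 g.2
      refine this.congr fun x => ?_
      have hx := (m.pos x).ne'
      simp [div_pow, Real.sq_sqrt (m.pos x).le, hx]
    · ext x
      have := (Real.sqrt_pos.2 (m.pos x)).ne'
      change √(m.weight x) * (g x / √(m.weight x)) = g x
      field_simp
  exact (LinearIsometryEquiv.ofSurjective L hs).toIsometryEquiv.completeSpace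

open scoped Classical in
/-- The function `δ_x`. -/
def delta (m : VertexMeasure V) (x : V) : Ell2 m :=
  mk (Pi.single x 1) <| summable_of_hasFiniteSupport <| (Set.finite_singleton x).subset fun y hy => by
    by_contra h
    have h' : y ≠ x := h
    simp [h'] at hy

end Ell2

/-! ### Functions of finite energy -/

namespace WeightedGraph

variable (G : WeightedGraph V)

theorem summable_edge {u v : V → ℝ}
    (hu : Summable fun p : V × V => G.b p.1 p.2 * (u p.1 - u p.2) ^ 2)
    (hv : Summable fun p : V × V => G.b p.1 p.2 * (v p.1 - v p.2) ^ 2) :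
    Summable fun p : V × V => G.b p.1 p.2 * ((u p.1 - u p.2) * (v p.1 - v p.2)) := by
  refine Summable.of_norm_bounded (hu.add hv) fun p => ?_
  have hb := G.b_nonneg p.1 p.2
  rw [Real.norm_eq_abs, abs_mul, abs_of_nonneg hb, ← mul_add]
  refine mul_le_mul_of_nonneg_left ?_ hb
  rw [abs_mul]
  nlinarith [sq_nonneg (|u p.1 - u p.2| - |v p.1 - v p.2|), sq_abs (u p.1 - u p.2),
    sq_abs (v p.1 - v p.2), sq_nonneg (u p.1 - u p.2), sq_nonneg (v p.1 - v p.2)]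

theorem summable_potential {u v : V → ℝ} (hu : Summable fun x => G.c x * u x ^ 2)
    (hv : Summable fun x => G.c x * v x ^ 2) : Summable fun x => G.c x * (u x * v x) := by
  refine Summable.of_norm_bounded (hu.add hv) fun x => ?_
  have hc := G.c_nonneg x
  rw [Real.norm_eq_abs, abs_mul, abs_of_nonneg hc, ← mul_add]
  refine mul_le_mul_of_nonneg_left ?_ hc
  rw [abs_mul]
  nlinarith [sq_nonneg (|u x| - |v x|), sq_abs (u x), sq_abs (v x), sq_nonneg (u x),
    sq_nonneg (v x)]

/-- The space of all functions `u : V → ℝ` of finite energy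
`(1/2) ∑ b(x,y) (u(x) - u(y))² + ∑ c(x) u(x)² < ∞`. -/
def finiteEnergy : Submodule ℝ (V → ℝ) where
  carrier := {u | (Summable fun p : V × V => G.b p.1 p.2 * (u p.1 - u p.2) ^ 2) ∧
    Summable fun x => G.c x * u x ^ 2}
  add_mem' {u v} hu hv := by
    refine ⟨((hu.1.add hv.1).add ((G.summable_edge hu.1 hv.1).mul_left 2)).congr fun p => ?_,
      ((hu.2.add hv.2).add ((G.summable_potential hu.2 hv.2).mul_left 2)).congr fun x => ?_⟩
    · simp only [Pi.add_apply]; ring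
    · simp only [Pi.add_apply]; ring
  zero_mem' := by simp [summable_zero]
  smul_mem' a u hu := by
    refine ⟨(hu.1.mul_left (a ^ 2)).congr fun p => ?_, (hu.2.mul_left (a ^ 2)).congr fun x => ?_⟩
    · simp only [Pi.smul_apply, smul_eq_mul]; ring
    · simp only [Pi.smul_apply, smul_eq_mul]; ring

/-- The energy form
`(u, v) ↦ (1/2) ∑ b(x,y) (u(x) - u(y)) (v(x) - v(y)) + ∑ c(x) u(x) v(x)`
on the functions of finite energy. -/
def energy : LinearMap.BilinForm ℝ G.finiteEnergy :=
  LinearMap.mk₂ ℝ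
    (fun u v => (1 / 2) * ∑' p : V × V, G.b p.1 p.2 *
        ((u.1 p.1 - u.1 p.2) * (v.1 p.1 - v.1 p.2)) + ∑' x, G.c x * (u.1 x * v.1 x))
    (fun u v w => by
      have h1 := (G.summable_edge u.2.1 w.2.1).tsum_add (G.summable_edge v.2.1 w.2.1)
      have h2 := (G.summable_potential u.2.2 w.2.2).tsum_add (G.summable_potential v.2.2 w.2.2)
      have e1 : (∑' p : V × V, G.b p.1 p.2 *
          (((u + v).1 p.1 - (u + v).1 p.2) * (w.1 p.1 - w.1 p.2))) = _ :=
        (tsum_congr fun p => by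
          simp only [Submodule.coe_add, Pi.add_apply]; ring).trans h1
      have e2 : (∑' x, G.c x * ((u + v).1 x * w.1 x)) = _ :=
        (tsum_congr fun x => by
          simp only [Submodule.coe_add, Pi.add_apply]; ring).trans h2
      rw [e1, e2]; ring)
    (fun a u v => by
      have e1 : (∑' p : V × V, G.b p.1 p.2 *
          (((a • u).1 p.1 - (a • u).1 p.2) * (v.1 p.1 - v.1 p.2))) = _ :=
        (tsum_congr fun p => by
          simp only [Submodule.coe_smul, Pi.smul_apply, smul_eq_mul]; ring).trans
          (tsum_mul_left (a := a) (f := fun p : V × V => G.b p.1 p.2 *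
            ((u.1 p.1 - u.1 p.2) * (v.1 p.1 - v.1 p.2))))
      have e2 : (∑' x, G.c x * ((a • u).1 x * v.1 x)) = _ :=
        (tsum_congr fun x => by
          simp only [Submodule.coe_smul, Pi.smul_apply, smul_eq_mul]; ring).trans
          (tsum_mul_left (a := a) (f := fun x => G.c x * (u.1 x * v.1 x)))
      rw [e1, e2, smul_eq_mul]; ring)
    (fun u v w => by
      have h1 := (G.summable_edge u.2.1 v.2.1).tsum_add (G.summable_edge u.2.1 w.2.1)
      have h2 := (G.summable_potential u.2.2 v.2.2).tsum_add (G.summable_potential u.2.2 w.2.2)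
      have e1 : (∑' p : V × V, G.b p.1 p.2 *
          ((u.1 p.1 - u.1 p.2) * ((v + w).1 p.1 - (v + w).1 p.2))) = _ :=
        (tsum_congr fun p => by
          simp only [Submodule.coe_add, Pi.add_apply]; ring).trans h1
      have e2 : (∑' x, G.c x * (u.1 x * (v + w).1 x)) = _ :=
        (tsum_congr fun x => by
          simp only [Submodule.coe_add, Pi.add_apply]; ring).trans h2
      rw [e1, e2]; ring)
    (fun a u v => by
      have e1 : (∑' p : V × V, G.b p.1 p.2 *
          ((u.1 p.1 - u.1 p.2) * ((a • v).1 p.1 - (a • v).1 p.2))) = _ :=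
        (tsum_congr fun p => by
          simp only [Submodule.coe_smul, Pi.smul_apply, smul_eq_mul]; ring).trans
          (tsum_mul_left (a := a) (f := fun p : V × V => G.b p.1 p.2 *
            ((u.1 p.1 - u.1 p.2) * (v.1 p.1 - v.1 p.2))))
      have e2 : (∑' x, G.c x * (u.1 x * (a • v).1 x)) = _ :=
        (tsum_congr fun x => by
          simp only [Submodule.coe_smul, Pi.smul_apply, smul_eq_mul]; ring).trans
          (tsum_mul_left (a := a) (f := fun x => G.c x * (u.1 x * v.1 x)))
      rw [e1, e2, smul_eq_mul]; ring)

theorem energy_apply (u v : G.finiteEnergy) :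
    G.energy u v = (1 / 2) * ∑' p : V × V, G.b p.1 p.2 *
        ((u.1 p.1 - u.1 p.2) * (v.1 p.1 - v.1 p.2)) + ∑' x, G.c x * (u.1 x * v.1 x) := rfl

end WeightedGraph

/-! ### Forms with a domain, and their operator, resolvent and semigroup -/

/-- A bilinear form defined on a subspace (its domain) of a Hilbert space `H`. -/
structure PartialForm (H : Type*) [AddCommGroup H] [Module ℝ H] where
  dom : Submodule ℝ H
  form : LinearMap.BilinForm ℝ dom

namespace PartialForm

/-- The restriction of a form to a subspace of its domain. -/
def restrict {H : Type*} [AddCommGroup H] [Module ℝ H] (Q : PartialForm H) (D : Submodule ℝ H)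
    (hD : D ≤ Q.dom) : PartialForm H where
  dom := D
  form := Q.form.compl₁₂ (Submodule.inclusion hD) (Submodule.inclusion hD)

variable {H : Type*} [NormedAddCommGroup H] [InnerProductSpace ℝ H]

/-- The graph of the operator associated with the form `Q`: all pairs `(u, w)` with `u ∈ D(Q)` and
`Q(u, v) = ⟨w, v⟩` for all `v ∈ D(Q)`. -/
def operatorGraph (Q : PartialForm H) : Submodule ℝ (H × H) where
  carrier := {p | ∃ hu : p.1 ∈ Q.dom, ∀ v : Q.dom, Q.form ⟨p.1, hu⟩ v = inner ℝ p.2 (v : H)}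
  add_mem' {p q} hp hq := by
    obtain ⟨hp, hp'⟩ := hp
    obtain ⟨hq, hq'⟩ := hq
    refine ⟨Q.dom.add_mem hp hq, fun v => ?_⟩
    have h : (⟨(p + q).1, Q.dom.add_mem hp hq⟩ : Q.dom) = ⟨p.1, hp⟩ + ⟨q.1, hq⟩ := rfl
    rw [h, map_add, LinearMap.add_apply, hp', hq', Prod.snd_add, inner_add_left]
  zero_mem' := by
    refine ⟨Q.dom.zero_mem, fun v => ?_⟩
    have h : (⟨(0 : H × H).1, Q.dom.zero_mem⟩ : Q.dom) = 0 := rfl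
    rw [h, map_zero, LinearMap.zero_apply, Prod.snd_zero, inner_zero_left]
  smul_mem' a p hp := by
    obtain ⟨hp, hp'⟩ := hp
    refine ⟨Q.dom.smul_mem a hp, fun v => ?_⟩
    have h : (⟨(a • p).1, Q.dom.smul_mem a hp⟩ : Q.dom) = a • ⟨p.1, hp⟩ := rfl
    rw [h, map_smul, LinearMap.smul_apply, hp', Prod.smul_snd, real_inner_smul_left, smul_eq_mul]

/-- The operator `L` associated with the form `Q`. -/
def operator (Q : PartialForm H) : H →ₗ.[ℝ] H := Q.operatorGraph.toLinearPMap

/-- `R` is the bounded two-sided inverse of `A + α`. -/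
def IsResolvent (A : H →ₗ.[ℝ] H) (α : ℝ) (R : H →L[ℝ] H) : Prop :=
  (∀ f : H, ∃ h : R f ∈ A.domain, A ⟨R f, h⟩ + α • R f = f) ∧
    ∀ u : A.domain, R (A u + α • (u : H)) = u

open scoped Classical in
/-- The resolvent `(L + α)⁻¹` of the operator `L` associated with `Q`. -/
def resolvent (Q : PartialForm H) (α : ℝ) : H →L[ℝ] H :=
  if h : ∃ R : H →L[ℝ] H, IsResolvent Q.operator α R then h.choose else 0

/-- The bounded (Yosida) approximation `L_λ = λ (1 - λ (L + λ)⁻¹) = λ L (L + λ)⁻¹` of `L`. -/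
def yosida (Q : PartialForm H) (l : ℝ) : H →L[ℝ] H :=
  l • (ContinuousLinearMap.id ℝ H - l • Q.resolvent l)

/-- The strongly continuous semigroup `e^{-tL}`, as the strong limit of the exponentials
`e^{-t L_n}` of the bounded approximations `L_n` of `L`. -/
def semigroup (Q : PartialForm H) (t : ℝ) (f : H) : H :=
  limUnder atTop fun n : ℕ => NormedSpace.exp ((-t) • Q.yosida n) f

end PartialForm

/-! ### The Neumann form and the regular form of a graph -/

namespace WeightedGraph

variable (G : WeightedGraph V) (m : VertexMeasure V)

/-- The Neumann form `Q^N`: the energy form restricted to all functions of finite energy in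
`ℓ²(V, m)`. -/
def neumannForm : PartialForm (Ell2 m) where
  dom := G.finiteEnergy.comap Ell2.toFun
  form := G.energy.compl₁₂ (Ell2.toFun.restrict fun _ h => h) (Ell2.toFun.restrict fun _ h => h)

theorem neumannForm_apply (u v : (G.neumannForm m).dom) :
    (G.neumannForm m).form u v = G.energy ⟨Ell2.toFun u.1, u.2⟩ ⟨Ell2.toFun v.1, v.2⟩ := rfl

theorem neumannForm_nonneg (u : (G.neumannForm m).dom) : 0 ≤ (G.neumannForm m).form u u := by
  rw [neumannForm_apply, energy_apply]
  refine add_nonneg (mul_nonneg (by norm_num) (tsum_nonneg fun p => ?_)) (tsum_nonneg fun x => ?_)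
  · exact mul_nonneg (G.b_nonneg _ _) (mul_self_nonneg _)
  · exact mul_nonneg (G.c_nonneg _) (mul_self_nonneg _)

theorem neumannForm_add_le (u v : (G.neumannForm m).dom) :
    (G.neumannForm m).form (u + v) (u + v) ≤
      2 * (G.neumannForm m).form u u + 2 * (G.neumannForm m).form v v := by
  have h := G.neumannForm_nonneg m (u - v)
  simp only [map_sub, map_add, LinearMap.sub_apply, LinearMap.add_apply] at h ⊢
  linarith

/-- The square `Q(u) + ‖u‖²` of the form norm, on the domain of the Neumann form. -/
def formNormSq (u : (G.neumannForm m).dom) : ℝ :=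
  (G.neumannForm m).form u u + ‖(u : Ell2 m)‖ ^ 2

theorem formNormSq_nonneg (u : (G.neumannForm m).dom) : 0 ≤ G.formNormSq m u :=
  add_nonneg (G.neumannForm_nonneg m u) (sq_nonneg _)

theorem formNormSq_add_le (u v : (G.neumannForm m).dom) :
    G.formNormSq m (u + v) ≤ 2 * G.formNormSq m u + 2 * G.formNormSq m v := by
  have h := G.neumannForm_add_le m u v
  have h2 := norm_add_le (u : Ell2 m) (v : Ell2 m)
  have h3 := norm_nonneg ((u : Ell2 m) + (v : Ell2 m))
  simp only [formNormSq, Submodule.coe_add]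
  nlinarith [sq_nonneg (‖(u : Ell2 m)‖ - ‖(v : Ell2 m)‖)]

theorem formNormSq_smul (a : ℝ) (u : (G.neumannForm m).dom) :
    G.formNormSq m (a • u) = a ^ 2 * G.formNormSq m u := by
  simp only [formNormSq, map_smul, LinearMap.smul_apply, smul_eq_mul, Submodule.coe_smul,
    norm_smul, mul_pow, Real.norm_eq_abs, sq_abs]
  ring

/-- The domain of the regular form: the closure of the finitely supported functions with respect
to the form norm. -/
def regularDomain : Submodule ℝ (Ell2 m) where
  carrier := {u | ∃ hu : u ∈ (G.neumannForm m).dom, ∃ φ : ℕ → (G.neumannForm m).dom,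
    (∀ n, (Function.support (φ n : Ell2 m)).Finite) ∧
      Tendsto (fun n => G.formNormSq m (⟨u, hu⟩ - φ n)) atTop (𝓝 0)}
  add_mem' {u v} hu hv := by
    obtain ⟨hu, φ, hφ, hφu⟩ := hu
    obtain ⟨hv, ψ, hψ, hψv⟩ := hv
    refine ⟨Submodule.add_mem _ hu hv, fun n => φ n + ψ n, fun n => ?_, ?_⟩
    · refine ((hφ n).union (hψ n)).subset ?_
      simp only [Submodule.coe_add, map_add]
      exact Function.support_add _ _
    · have h := (hφu.const_mul 2).add (hψv.const_mul 2)
      simp only [mul_zero, add_zero] at h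
      refine squeeze_zero (fun n => G.formNormSq_nonneg m _) (fun n => ?_) h
      refine le_trans (le_of_eq ?_) (G.formNormSq_add_le m _ _)
      congr 1
      ext x
      simp only [Submodule.coe_sub, Submodule.coe_add, map_sub, map_add, Pi.sub_apply,
        Pi.add_apply]
      ring
  zero_mem' := by
    refine ⟨Submodule.zero_mem _, fun _ => 0, fun n => by simp, ?_⟩
    have h : (⟨0, Submodule.zero_mem _⟩ : (G.neumannForm m).dom) - 0 = 0 := by
      rw [sub_zero]; rfl
    simp [h, formNormSq]
  smul_mem' a u hu := by
    obtain ⟨hu, φ, hφ, hφu⟩ := hu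
    refine ⟨Submodule.smul_mem _ a hu, fun n => a • φ n, fun n => ?_, ?_⟩
    · refine (hφ n).subset ?_
      simp only [Submodule.coe_smul, map_smul]
      exact Function.support_const_smul_subset _ _
    · have h := hφu.const_mul (a ^ 2)
      rw [mul_zero] at h
      refine h.congr fun n => ?_
      rw [← formNormSq_smul]
      congr 1
      ext x
      simp [mul_sub]

theorem regularDomain_le : G.regularDomain m ≤ (G.neumannForm m).dom := fun _ h => h.1

/-- The regular form `Q^D`: the energy form restricted to the closure of the finitely supported
functions with respect to the form norm. -/
def regularForm : PartialForm (Ell2 m) :=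
  (G.neumannForm m).restrict (G.regularDomain m) (G.regularDomain_le m)

end WeightedGraph

/-! ### Recurrence and stochastic completeness -/

namespace PartialForm

variable {m : VertexMeasure V}

/-- `Q` is recurrent: `G(x, y) = ∫₀^∞ (e^{-tL} δ_x)(y) dt = ∞` for all `x, y`. -/
def IsRecurrent (Q : PartialForm (Ell2 m)) : Prop :=
  ∀ x y : V, ∫⁻ t in Set.Ioi (0 : ℝ), ENNReal.ofReal (Q.semigroup t (Ell2.delta m x) y) = ⊤

/-- The extension of the resolvent `(L + α)⁻¹` to bounded functions `u ≥ 0` takes the value `w`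
at `u`: for all nonnegative `f_n ∈ ℓ²(V, m)` increasing pointwise to `u`, the functions
`(L + α)⁻¹ f_n` converge pointwise to `w`. -/
def ExtendedResolventEq (Q : PartialForm (Ell2 m)) (α : ℝ) (u w : V → ℝ) : Prop :=
  ∀ f : ℕ → Ell2 m, (∀ n x, 0 ≤ f n x) → (∀ x, Monotone fun n => f n x) →
    (∀ x, Tendsto (fun n => f n x) atTop (𝓝 (u x))) →
      ∀ x, Tendsto (fun n => Q.resolvent α (f n) x) atTop (𝓝 (w x))

/-- `Q` is stochastically complete: `(L + 1)⁻¹ 1 = 1`. -/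
def IsStochasticallyComplete (Q : PartialForm (Ell2 m)) : Prop :=
  Q.ExtendedResolventEq 1 (fun _ => 1) (fun _ => 1)

end PartialForm

end

/-!
Write `Q^D`, `Q^N` for the regular and the Neumann form and `L` for the operator of `Q^D`. The proof
passes through a *null sequence*: finitely supported `0 ≤ e_n ≤ 1` with `e_n → 1` pointwise and
`Q(e_n) → 0`.

**Recurrence gives a null sequence.** Suppose that `⟨v, δ_x⟩² ≤ c Q(v)` on the domain of `Q^D`. The
Yosida approximations `Y = λ L (L + λ)⁻¹` inherit such an inequality `⟨w, δ_x⟩² ≤ C ⟨Y w, w⟩` with `C`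
independent of `λ ≥ 1` (`PartialForm.IsNonnegClosed.inner_sq_le_inner_yosida`). For
`w = ∫₀ᵀ e^{-tY} δ_x dt` one has `Y w = δ_x - e^{-TY} δ_x`, so `⟨Y w, w⟩ ≤ ⟨w, δ_x⟩` and therefore
`∫₀ᵀ ⟨e^{-tY} δ_x, δ_x⟩ dt = ⟨w, δ_x⟩ ≤ C` (`BoundedExp.integral_inner_exp_le`). As `e^{-tY}` converges
strongly to the semigroup (`PartialForm.IsNonnegClosed.tendsto_exp_yosida`), Fatou's lemma bounds the
Green function at `(x, x)`, against recurrence. Hence no such inequality holds, and there are finitely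
supported `φ_n` with `φ_n(x) = 1` and `Q(φ_n) → 0`; truncating them to `[0, 1]` and following paths
through the connected graph gives the null sequence (`WeightedGraph.exists_null_sequence`).

The resolvents of `Q^D` exist because `Q^D(u, v) = ⟨∇u, ∇v⟩` for a gradient with closed graph: up to
scaling, `(L + α)⁻¹ f` is the first component of the orthogonal projection of `(f, 0)` onto that graph
(`PartialForm.exists_isResolvent_of_closed`).

**Equality of the forms.** A bounded `u` in the domain of `Q^N` is the limit of `u e_n` in the form
norm, and a general one is the limit of its truncations; both limits are instances of dominated
convergence (`WeightedGraph.mem_regularDomain_of_bounded`, `WeightedGraph.mem_regularDomain_of_clamp`).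

**Stochastic completeness.** Since the domain now contains all truncations of its elements, the
resolvent is Markovian (`WeightedGraph.resolvent_markov`). For `0 ≤ f ≤ 1` and
`v = 1 - (L + 1)⁻¹ f`, testing the equation of `v` with `e_n² v` gives
`∑ e_n² v² m ≤ Q(e_n) + ∑ (1 - f) e_n² m` (`WeightedGraph.caccioppoli`). Letting first `f ↑ 1` and then
`n → ∞` forces `v → 0`.
-/

noncomputable section

/-! ### Exponentials of bounded operators on a Hilbert space -/

namespace BoundedExp

variable {H : Type*} [NormedAddCommGroup H] [InnerProductSpace ℝ H] [CompleteSpace H]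

theorem hasDerivAt_exp_smul_apply (A : H →L[ℝ] H) (f : H) (t : ℝ) :
    HasDerivAt (fun s : ℝ => NormedSpace.exp (s • A) f) (A (NormedSpace.exp (t • A) f)) t :=
  (hasDerivAt_exp_smul_const' (𝕂 := ℝ) A t).clm_apply (hasDerivAt_const t f) |>.congr_deriv
    (by simp)

theorem continuous_exp_smul_apply (A : H →L[ℝ] H) (f : H) :
    Continuous fun s : ℝ => NormedSpace.exp (s • A) f :=
  continuous_iff_continuousAt.2 fun t => (hasDerivAt_exp_smul_apply A f t).continuousAt

/-- A bounded dissipative operator generates a contraction semigroup: the squared norm of an orbit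
has nonpositive derivative. -/
theorem norm_exp_smul_apply_le {A : H →L[ℝ] H} (hA : ∀ f, inner ℝ (A f) f ≤ 0) {t : ℝ}
    (ht : 0 ≤ t) (f : H) : ‖NormedSpace.exp (t • A) f‖ ≤ ‖f‖ := by
  have hd : ∀ s, HasDerivAt (fun s : ℝ => ‖NormedSpace.exp (s • A) f‖ ^ 2)
      (2 * inner ℝ (NormedSpace.exp (s • A) f) (A (NormedSpace.exp (s • A) f))) s :=
    fun s => (hasDerivAt_exp_smul_apply A f s).norm_sq
  have hanti : Antitone fun s : ℝ => ‖NormedSpace.exp (s • A) f‖ ^ 2 := by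
    refine antitone_of_deriv_nonpos (fun s => (hd s).differentiableAt) fun s => ?_
    rw [(hd s).deriv, real_inner_comm]
    linarith [hA (NormedSpace.exp (s • A) f)]
  have h := hanti ht
  simp only [zero_smul, NormedSpace.exp_zero, one_apply_eq_self] at h
  exact (pow_le_pow_iff_left₀ (norm_nonneg _) (norm_nonneg _) two_ne_zero).1 h

/-- Interpolating between the two exponentials by `s ↦ exp (s A) exp ((1 - s) B) f`, whose
derivative is `exp (s A) exp ((1 - s) B) (A - B) f`. -/
theorem norm_exp_apply_sub_le {A B : H →L[ℝ] H} (hAB : Commute A B)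
    (hA : ∀ f, inner ℝ (A f) f ≤ 0) (hB : ∀ f, inner ℝ (B f) f ≤ 0) (f : H) :
    ‖NormedSpace.exp A f - NormedSpace.exp B f‖ ≤ ‖A f - B f‖ := by
  have hd : ∀ s : ℝ, HasDerivAt
      (fun s : ℝ => NormedSpace.exp (s • A) (NormedSpace.exp ((1 - s) • B) f))
      (NormedSpace.exp (s • A) (NormedSpace.exp ((1 - s) • B) (A f - B f))) s := by
    intro s
    have h1 := hasDerivAt_exp_smul_const (𝕂 := ℝ) A s
    have h2 : HasDerivAt (fun s : ℝ => NormedSpace.exp ((1 - s) • B) f)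
        (-(B (NormedSpace.exp ((1 - s) • B) f))) s := by
      exact ((hasDerivAt_exp_smul_apply B f (1 - s)).scomp s
        ((hasDerivAt_id s).const_sub 1)).congr_deriv (by simp)
    refine (h1.clm_apply h2).congr_deriv ?_
    have c1 : Commute A (NormedSpace.exp ((1 - s) • B)) := (hAB.smul_right (1 - s)).exp_right
    have c2 : Commute B (NormedSpace.exp ((1 - s) • B)) :=
      ((Commute.refl B).smul_right (1 - s)).exp_right
    have e1 := congrArg (fun T : H →L[ℝ] H => T f) c1.eq
    have e2 := congrArg (fun T : H →L[ℝ] H => T f) c2.eq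
    simp only [mul_apply_eq_comp] at e1 e2
    simp only [mul_apply_eq_comp, map_neg, map_sub, e1, e2]
    abel
  have h := norm_image_sub_le_of_norm_deriv_le_segment_01' (C := ‖A f - B f‖)
    (fun s _ => (hd s).hasDerivWithinAt) (fun s hs =>
      (norm_exp_smul_apply_le hA hs.1 _).trans
        (norm_exp_smul_apply_le hB (by linarith [hs.2]) _))
  simpa using h

theorem inner_exp_smul_apply_self_nonneg {A : H →L[ℝ] H} (hA : IsSelfAdjoint A) (t : ℝ) (f : H) :
    0 ≤ inner ℝ (NormedSpace.exp (t • A) f) f := by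
  let _ : NormedAlgebra ℚ (H →L[ℝ] H) := NormedAlgebra.restrictScalars ℚ ℝ _
  have hs : IsSelfAdjoint (NormedSpace.exp ((t / 2) • A)) :=
    (IsSelfAdjoint.smul (IsSelfAdjoint.all (t / 2)) hA).exp
  have he : NormedSpace.exp (t • A) =
      NormedSpace.exp ((t / 2) • A) * NormedSpace.exp ((t / 2) • A) := by
    rw [← NormedSpace.exp_add_of_commute (Commute.refl _), ← add_smul, add_halves]
  rw [he, mul_apply_eq_comp]
  have := (ContinuousLinearMap.isSelfAdjoint_iff_isSymmetric.1 hs)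
    (NormedSpace.exp ((t / 2) • A) f) f
  simp only [ContinuousLinearMap.coe_coe] at this
  rw [this]
  exact real_inner_self_nonneg

/-- If `⟨w, d⟩² ≤ C ⟨Y w, w⟩` for all `w`, then `∫₀ᵀ ⟨exp (-t Y) d, d⟩ dt ≤ C`. For
`w = ∫₀ᵀ exp (-t Y) d dt` one has `Y w = d - exp (-T Y) d`, hence `⟨Y w, w⟩ ≤ ⟨w, d⟩`, so that
`⟨w, d⟩² ≤ C ⟨w, d⟩`. -/
theorem integral_inner_exp_le {Y : H →L[ℝ] H} (hY : IsSelfAdjoint Y) {C : ℝ} (d : H)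
    (hC : ∀ w, (inner ℝ w d) ^ 2 ≤ C * inner ℝ (Y w) w) (hC0 : 0 ≤ C) {T : ℝ} (hT : 0 ≤ T) :
    ∫ t in (0 : ℝ)..T, inner ℝ (NormedSpace.exp ((-t) • Y) d) d ≤ C := by
  have hYn : ∀ t : ℝ, (-t) • Y = t • (-Y) := fun t => by simp
  simp only [hYn]
  have hcont := continuous_exp_smul_apply (-Y) d
  have hint : IntervalIntegrable (fun t : ℝ => NormedSpace.exp (t • (-Y)) d) volume 0 T :=
    hcont.intervalIntegrable _ _
  set w := ∫ t in (0 : ℝ)..T, NormedSpace.exp (t • (-Y)) d with hw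
  have hinner : ∀ g : H, ∫ t in (0 : ℝ)..T, inner ℝ (NormedSpace.exp (t • (-Y)) d) g =
      inner ℝ w g := by
    intro g
    have := (innerSL ℝ g).intervalIntegral_comp_comm hint
    simp only [innerSL_apply_apply] at this
    rw [real_inner_comm, ← this]
    exact intervalIntegral.integral_congr fun t _ => real_inner_comm _ _
  have hYw : Y w = d - NormedSpace.exp (T • (-Y)) d := by
    have h1 := (-Y).intervalIntegral_comp_comm hint
    have h2 := intervalIntegral.integral_eq_sub_of_hasDerivAt (a := 0) (b := T)
      (fun t _ => hasDerivAt_exp_smul_apply (-Y) d t)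
      (((-Y).continuous.comp hcont).intervalIntegrable _ _)
    rw [h1, ← hw] at h2
    simp only [zero_smul, NormedSpace.exp_zero, one_apply_eq_self,
      neg_apply] at h2
    rw [← neg_neg (Y w), h2]
    abel
  have hpos : 0 ≤ inner ℝ (NormedSpace.exp (T • (-Y)) d) w := by
    rw [real_inner_comm, ← hinner]
    refine intervalIntegral.integral_nonneg hT fun t _ => ?_
    let _ : NormedAlgebra ℚ (H →L[ℝ] H) := NormedAlgebra.restrictScalars ℚ ℝ _
    have hs : IsSelfAdjoint (NormedSpace.exp (T • (-Y))) :=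
      (IsSelfAdjoint.smul (IsSelfAdjoint.all T) hY.neg).exp
    have h3 := (ContinuousLinearMap.isSelfAdjoint_iff_isSymmetric.1 hs)
      (NormedSpace.exp (t • (-Y)) d) d
    simp only [ContinuousLinearMap.coe_coe] at h3
    rw [← h3, ← mul_apply_eq_comp, ← NormedSpace.exp_add_of_commute
      (((Commute.refl (-Y)).smul_left T).smul_right t), ← add_smul]
    exact inner_exp_smul_apply_self_nonneg hY.neg _ _
  rw [hinner]
  have h4 := hC w
  rw [hYw, inner_sub_left, real_inner_comm w d] at h4
  by_contra! hlt
  nlinarith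
end BoundedExp

/-! ### Resolvents of nonnegative symmetric forms -/

namespace PartialForm

variable {H : Type*} [NormedAddCommGroup H] [InnerProductSpace ℝ H]

/-- A densely defined symmetric nonnegative form whose operator `L` has resolvents `(L + α)⁻¹` for
all `α > 0`; for such forms the last condition expresses closedness. -/
structure IsNonnegClosed (Q : PartialForm H) : Prop where
  dense : Dense (Q.dom : Set H)
  symm : ∀ u v, Q.form u v = Q.form v u
  nonneg : ∀ u, 0 ≤ Q.form u u
  exists_resolvent : ∀ α : ℝ, 0 < α → ∃ R : H →L[ℝ] H, IsResolvent Q.operator α R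

variable {Q : PartialForm H}

theorem mem_operatorGraph_unique (hd : Dense (Q.dom : Set H)) :
    ∀ p ∈ Q.operatorGraph, p.1 = 0 → p.2 = 0 := by
  rintro ⟨u, w⟩ ⟨hu, h⟩ h0
  simp only at h0 hu h
  subst h0
  refine hd.eq_zero_of_inner_left (𝕜 := ℝ) fun v hv => ?_
  have h1 := h ⟨v, hv⟩
  have h2 : (⟨0, hu⟩ : Q.dom) = 0 := rfl
  rw [h2, map_zero, LinearMap.zero_apply] at h1
  exact h1.symm

/-- The density of the domain makes the operator graph single-valued, so that the operator does not
depend on the choice made for multivalued graphs. -/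
theorem mem_operator_graph_iff (hd : Dense (Q.dom : Set H)) {u w : H} :
    (∃ h : u ∈ Q.operator.domain, Q.operator ⟨u, h⟩ = w) ↔
      ∃ h : u ∈ Q.dom, ∀ v : Q.dom, Q.form ⟨u, h⟩ v = inner ℝ w (v : H) := by
  have hg := Submodule.toLinearPMap_graph_eq _ (mem_operatorGraph_unique hd)
  have h1 : (u, w) ∈ Q.operator.graph ↔ (u, w) ∈ Q.operatorGraph := by
    rw [operator, hg]
  refine Iff.trans ?_ h1
  rw [LinearPMap.mem_graph_iff]
  constructor
  · rintro ⟨h, rfl⟩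
    exact ⟨⟨u, h⟩, rfl, rfl⟩
  · rintro ⟨⟨y, hy⟩, rfl, h⟩
    exact ⟨hy, h⟩

/-- The weak equation `Q(R f, ·) + α ⟨R f, ·⟩ = ⟨f, ·⟩` makes `R` a right inverse of `L + α`; it is also
a left inverse, as `Q + α ⟨·, ·⟩` is positive definite. -/
theorem isResolvent_of_weak (hd : Dense (Q.dom : Set H)) (hn : ∀ u, 0 ≤ Q.form u u) {α : ℝ}
    (hα : 0 < α) {R : H →L[ℝ] H} (hR : ∀ f, ∃ h : R f ∈ Q.dom, ∀ v : Q.dom,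
      Q.form ⟨R f, h⟩ v = inner ℝ (f - α • R f) (v : H)) : IsResolvent Q.operator α R := by
  refine ⟨fun f => ?_, fun u => ?_⟩
  · obtain ⟨h, h'⟩ := (mem_operator_graph_iff hd).2 (hR f)
    exact ⟨h, by rw [h']; abel⟩
  · obtain ⟨h, hu⟩ := (mem_operator_graph_iff hd).1 ⟨u.2, rfl⟩
    obtain ⟨h', hu'⟩ := hR (Q.operator u + α • (u : H))
    set f := Q.operator u + α • (u : H) with hf
    set z : Q.dom := ⟨u, h⟩ - ⟨R f, h'⟩ with hz
    have e1 : Q.form z z = -(α * inner ℝ (z : H) (z : H)) := by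
      have : Q.form z z = Q.form ⟨u, h⟩ z - Q.form ⟨R f, h'⟩ z := by
        rw [← LinearMap.sub_apply, ← map_sub]
      rw [this, hu z, hu' z, ← inner_sub_left, ← real_inner_smul_left, ← inner_neg_left]
      congr 1
      simp only [hf, hz, Submodule.coe_sub, smul_sub]
      abel
    have e2 := hn z
    rw [e1, real_inner_self_eq_norm_sq] at e2
    have e3 : ‖(z : H)‖ = 0 := by
      by_contra hne
      have : 0 < α * ‖(z : H)‖ ^ 2 := by positivity
      linarith
    have e4 : (u : H) - R f = 0 := norm_eq_zero.1 e3
    exact (sub_eq_zero.1 e4).symm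

/-- If `Q(u, v) = ⟨T u, T v⟩` for an operator `T` with closed graph, then `α (L + α)⁻¹ f` is the
first component of the orthogonal projection of `(f, 0)` onto the graph of `α^{-1/2} T`. -/
theorem exists_isResolvent_of_closed {F : Type*} [NormedAddCommGroup F] [InnerProductSpace ℝ F]
    [CompleteSpace H] [CompleteSpace F] (hd : Dense (Q.dom : Set H)) (T : Q.dom →ₗ[ℝ] F)
    (hT : ∀ u v, Q.form u v = inner ℝ (T u) (T v))
    (hcl : IsClosed {p : H × F | ∃ h : p.1 ∈ Q.dom, T ⟨p.1, h⟩ = p.2}) {α : ℝ} (hα : 0 < α) :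
    ∃ R : H →L[ℝ] H, IsResolvent Q.operator α R := by
  have hsα : √α * √α = α := Real.mul_self_sqrt hα.le
  have hs0 : √α ≠ 0 := (Real.sqrt_pos.2 hα).ne'
  let K : Submodule ℝ (WithLp 2 (H × F)) :=
    { carrier := {p | ∃ h : p.fst ∈ Q.dom, T ⟨p.fst, h⟩ = √α • p.snd}
      add_mem' := by
        rintro p q ⟨hp, hp'⟩ ⟨hq, hq'⟩
        refine ⟨Q.dom.add_mem hp hq, ?_⟩
        have : (⟨(p + q).fst, Q.dom.add_mem hp hq⟩ : Q.dom) = ⟨p.fst, hp⟩ + ⟨q.fst, hq⟩ := rfl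
        rw [this, map_add, hp', hq', ← smul_add]
        rfl
      zero_mem' := by
        refine ⟨Q.dom.zero_mem, ?_⟩
        have : (⟨(0 : WithLp 2 (H × F)).fst, Q.dom.zero_mem⟩ : Q.dom) = 0 := rfl
        rw [this, map_zero]
        simp
      smul_mem' := by
        rintro a p ⟨hp, hp'⟩
        refine ⟨Q.dom.smul_mem a hp, ?_⟩
        have : (⟨(a • p).fst, Q.dom.smul_mem a hp⟩ : Q.dom) = a • ⟨p.fst, hp⟩ := rfl
        rw [this, map_smul, hp', smul_comm]
        rfl }
  have hK : IsClosed (K : Set (WithLp 2 (H × F))) := by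
    have hc : Continuous fun p : WithLp 2 (H × F) => (p.fst, √α • p.snd) := by
      have := WithLp.prod_continuous_ofLp 2 H F
      exact (continuous_fst.comp this).prodMk ((continuous_snd.comp this).const_smul _)
    exact hcl.preimage hc
  have : CompleteSpace K := hK.completeSpace_coe
  let ι : H →L[ℝ] WithLp 2 (H × F) :=
    (WithLp.prodContinuousLinearEquiv 2 ℝ H F).symm.toContinuousLinearMap ∘L
      ContinuousLinearMap.inl ℝ H F
  let π : WithLp 2 (H × F) →L[ℝ] H :=
    ContinuousLinearMap.fst ℝ H F ∘L
      (WithLp.prodContinuousLinearEquiv 2 ℝ H F).toContinuousLinearMap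
  refine ⟨α⁻¹ • (π ∘L K.starProjection ∘L ι), isResolvent_of_weak hd
    (fun u => by rw [hT]; exact real_inner_self_nonneg) hα fun f => ?_⟩
  set p := K.starProjection (ι f) with hp
  have hRf : (α⁻¹ • (π ∘L K.starProjection ∘L ι)) f = α⁻¹ • p.fst := rfl
  rw [hRf]
  obtain ⟨hpd, hpT⟩ : p ∈ K := Submodule.starProjection_apply_mem _ _
  refine ⟨Q.dom.smul_mem _ hpd, fun v => ?_⟩
  have hv : WithLp.toLp 2 ((v : H), (√α)⁻¹ • T v) ∈ K :=
    ⟨v.2, by simp [smul_smul, hs0]⟩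
  have horth := K.starProjection_inner_eq_zero (ι f) _ hv
  rw [← hp, WithLp.prod_inner_apply] at horth
  have e1 : (ι f - p).ofLp.1 = f - p.fst := rfl
  have e2 : (ι f - p).ofLp.2 = -p.snd := by
    change (0 : F) - p.snd = _
    simp
  rw [e1, e2] at horth
  have e3 : (⟨α⁻¹ • p.fst, Q.dom.smul_mem _ hpd⟩ : Q.dom) = α⁻¹ • ⟨p.fst, hpd⟩ := rfl
  rw [e3, map_smul, LinearMap.smul_apply, hT, hpT, smul_smul, mul_inv_cancel₀ hα.ne', one_smul,
    real_inner_smul_left, smul_eq_mul]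
  simp only [inner_neg_left, real_inner_smul_right] at horth
  have e4 : α⁻¹ * √α = (√α)⁻¹ := by
    field_simp
    rw [pow_two, hsα]
  rw [← mul_assoc, e4]
  linarith

/-! ### Properties of the resolvent and of the Yosida approximation -/

namespace IsNonnegClosed

theorem isResolvent (hQ : Q.IsNonnegClosed) {α : ℝ} (hα : 0 < α) :
    IsResolvent Q.operator α (Q.resolvent α) := by
  rw [resolvent, dif_pos (hQ.exists_resolvent α hα)]
  exact (hQ.exists_resolvent α hα).choose_spec

theorem resolvent_mem (hQ : Q.IsNonnegClosed) {α : ℝ} (hα : 0 < α) (f : H) :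
    Q.resolvent α f ∈ Q.dom := by
  obtain ⟨h, -⟩ := (hQ.isResolvent hα).1 f
  exact ((mem_operator_graph_iff hQ.dense).1 ⟨h, rfl⟩).1

theorem form_resolvent (hQ : Q.IsNonnegClosed) {α : ℝ} (hα : 0 < α) (f : H) (v : Q.dom) :
    Q.form ⟨Q.resolvent α f, hQ.resolvent_mem hα f⟩ v =
      inner ℝ (f - α • Q.resolvent α f) (v : H) := by
  obtain ⟨h, h'⟩ := (hQ.isResolvent hα).1 f
  rw [← eq_sub_iff_add_eq] at h'
  exact ((mem_operator_graph_iff hQ.dense).1 ⟨h, h'⟩).2 v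

/-- The resolvent identity. -/
theorem resolvent_sub (hQ : Q.IsNonnegClosed) {α β : ℝ} (hα : 0 < α) (hβ : 0 < β) (f : H) :
    Q.resolvent α f - Q.resolvent β f = (β - α) • Q.resolvent α (Q.resolvent β f) := by
  obtain ⟨h, h'⟩ := (hQ.isResolvent hβ).1 f
  have h1 := (hQ.isResolvent hα).2 ⟨_, h⟩
  rw [← eq_sub_iff_add_eq] at h'
  rw [h', map_add, map_sub, map_smul, map_smul] at h1
  rw [sub_smul]
  linear_combination (norm := module) h1

/-- Exchanging the two parameters in the resolvent identity shows that the resolvents commute. -/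
theorem resolvent_commute (hQ : Q.IsNonnegClosed) {α β : ℝ} (hα : 0 < α) (hβ : 0 < β) :
    Commute (Q.resolvent α) (Q.resolvent β) := by
  rcases eq_or_ne α β with rfl | hne
  · exact Commute.refl _
  ext f
  simp only [mul_apply_eq_comp]
  have h1 := hQ.resolvent_sub hα hβ f
  have h2 := hQ.resolvent_sub hβ hα f
  have h3 : (β - α) • (Q.resolvent α (Q.resolvent β f) - Q.resolvent β (Q.resolvent α f)) = 0 := by
    rw [smul_sub, ← h1, ← neg_sub α β, neg_smul, ← h2]
    abel
  exact sub_eq_zero.1 ((smul_eq_zero.1 h3).resolve_left (sub_ne_zero.2 hne.symm))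

theorem inner_resolvent_symm (hQ : Q.IsNonnegClosed) {α : ℝ} (hα : 0 < α) (f g : H) :
    inner ℝ (Q.resolvent α f) g = inner ℝ f (Q.resolvent α g) := by
  have h1 := hQ.form_resolvent hα f ⟨_, hQ.resolvent_mem hα g⟩
  have h2 := hQ.form_resolvent hα g ⟨_, hQ.resolvent_mem hα f⟩
  rw [hQ.symm, h2, inner_sub_left, inner_sub_left, real_inner_smul_left, real_inner_smul_left,
    real_inner_comm (Q.resolvent α f) g, real_inner_comm (Q.resolvent α f)] at h1
  linarith

theorem norm_smul_resolvent_le (hQ : Q.IsNonnegClosed) {α : ℝ} (hα : 0 < α) (f : H) :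
    ‖α • Q.resolvent α f‖ ≤ ‖f‖ := by
  have h1 := hQ.form_resolvent hα f ⟨_, hQ.resolvent_mem hα f⟩
  have h2 := hQ.nonneg ⟨_, hQ.resolvent_mem hα f⟩
  rw [h1, inner_sub_left, real_inner_smul_left, real_inner_self_eq_norm_sq] at h2
  have h3 := real_inner_le_norm f (Q.resolvent α f)
  rw [norm_smul, Real.norm_of_nonneg hα.le]
  rcases (norm_nonneg (Q.resolvent α f)).eq_or_lt with h0 | h0
  · rw [← h0, mul_zero]; exact norm_nonneg _
  · nlinarith

/-- The Yosida approximation satisfies `⟨Y f, f⟩ = Q(v) + λ⁻¹ ‖Y f‖²` with `v = λ (L + λ)⁻¹ f`,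
since `Y f = L v` and `f = v + λ⁻¹ L v`. -/
theorem inner_yosida_self (hQ : Q.IsNonnegClosed) {l : ℝ} (hl : 0 < l) (f : H) :
    inner ℝ (Q.yosida l f) f =
      Q.form (l • ⟨_, hQ.resolvent_mem hl f⟩) (l • ⟨_, hQ.resolvent_mem hl f⟩) +
        l⁻¹ * ‖Q.yosida l f‖ ^ 2 := by
  have h1 := hQ.form_resolvent hl f ⟨_, hQ.resolvent_mem hl f⟩
  have hy : Q.yosida l f = l • (f - l • Q.resolvent l f) := rfl
  rw [map_smul, map_smul, LinearMap.smul_apply, h1, ← real_inner_self_eq_norm_sq, hy]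
  simp only [real_inner_smul_left, real_inner_smul_right, inner_sub_left, inner_sub_right,
    smul_eq_mul, real_inner_comm f (Q.resolvent l f)]
  field_simp
  ring

theorem inner_yosida_self_nonneg (hQ : Q.IsNonnegClosed) {l : ℝ} (hl : 0 < l) (f : H) :
    0 ≤ inner ℝ (Q.yosida l f) f := by
  rw [hQ.inner_yosida_self hl]
  have := hQ.nonneg (l • ⟨_, hQ.resolvent_mem hl f⟩)
  positivity

theorem isSelfAdjoint_yosida [CompleteSpace H] (hQ : Q.IsNonnegClosed) {l : ℝ} (hl : 0 < l) :
    IsSelfAdjoint (Q.yosida l) := by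
  rw [ContinuousLinearMap.isSelfAdjoint_iff_isSymmetric]
  intro f g
  change inner ℝ (l • (f - l • Q.resolvent l f)) g = inner ℝ f (l • (g - l • Q.resolvent l g))
  simp only [real_inner_smul_left, real_inner_smul_right, inner_sub_left, inner_sub_right,
    hQ.inner_resolvent_symm hl f g]

theorem yosida_commute (hQ : Q.IsNonnegClosed) {k l : ℝ} (hk : 0 < k) (hl : 0 < l) :
    Commute (Q.yosida k) (Q.yosida l) := by
  have h := hQ.resolvent_commute hk hl
  have e : ∀ A : H →L[ℝ] H, Commute (ContinuousLinearMap.id ℝ H) A := fun A => Commute.one_left A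
  exact (((e _).sub_right ((e _).smul_right _)).sub_left
    (((e _).symm.sub_right (h.smul_right _)).smul_left _)).smul_left _ |>.smul_right _

/-- `λ (L + λ)⁻¹ → 1` strongly: on the form domain `‖f - λ (L + λ)⁻¹ f‖² ≤ Q(f) / (4 λ)`, and the
operators are contractions. -/
theorem tendsto_smul_resolvent (hQ : Q.IsNonnegClosed) (f : H) :
    Tendsto (fun n : ℕ => (n : ℝ) • Q.resolvent n f) atTop (𝓝 f) := by
  have hdom : ∀ (g : Q.dom) (l : ℝ), 0 < l →
      ‖(g : H) - l • Q.resolvent l g‖ ^ 2 ≤ Q.form g g / 4 / l := by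
    intro g l hl
    set v : Q.dom := l • ⟨_, hQ.resolvent_mem hl (g : H)⟩ with hv
    have h1 : Q.form v (g - v) = l * ‖(g : H) - l • Q.resolvent l g‖ ^ 2 := by
      rw [hv, map_smul, LinearMap.smul_apply, hQ.form_resolvent hl, ← hv,
        ← real_inner_self_eq_norm_sq]
      rfl
    have h2 := hQ.nonneg ((2 : ℝ) • v - g)
    simp only [map_sub, map_smul, LinearMap.sub_apply, LinearMap.smul_apply, smul_eq_mul,
      hQ.symm g v] at h1 h2
    rw [le_div_iff₀ hl]
    linarith
  rw [Metric.tendsto_atTop]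
  intro ε hε
  obtain ⟨g, hg, hfg⟩ := Metric.mem_closure_iff.1 (hQ.dense f) (ε / 4) (by positivity)
  have hlim : Tendsto (fun n : ℕ => Q.form ⟨g, hg⟩ ⟨g, hg⟩ / 4 / (n : ℝ)) atTop (𝓝 0) :=
    tendsto_const_div_atTop_nhds_zero_nat _
  obtain ⟨N, hN⟩ := eventually_atTop.1
    ((hlim.eventually_lt_const (show 0 < (ε / 4) ^ 2 by positivity)).and (eventually_gt_atTop 0))
  refine ⟨N, fun n hn => ?_⟩
  obtain ⟨h1, h2⟩ := hN n hn
  have hn0 : (0 : ℝ) < n := by exact_mod_cast h2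
  have h3 : ‖g - (n : ℝ) • Q.resolvent n g‖ < ε / 4 :=
    lt_of_pow_lt_pow_left₀ 2 (by positivity) ((hdom ⟨g, hg⟩ n hn0).trans_lt h1)
  have h4 := hQ.norm_smul_resolvent_le hn0 (f - g)
  rw [dist_eq_norm] at hfg ⊢
  have h5 : (n : ℝ) • Q.resolvent n f - f =
      (n : ℝ) • Q.resolvent n (f - g) - (g - (n : ℝ) • Q.resolvent n g) - (f - g) := by
    rw [map_sub, smul_sub]; abel
  rw [h5]
  refine (norm_sub_le _ _).trans_lt ?_
  have := norm_sub_le ((n : ℝ) • Q.resolvent n (f - g)) (g - (n : ℝ) • Q.resolvent n g)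
  linarith

/-! ### Convergence of the exponentials of the Yosida approximations -/

theorem norm_exp_yosida_apply_le [CompleteSpace H] (hQ : Q.IsNonnegClosed) {l t : ℝ} (hl : 0 < l)
    (ht : 0 ≤ t) (f : H) : ‖NormedSpace.exp ((-t) • Q.yosida l) f‖ ≤ ‖f‖ := by
  have := BoundedExp.norm_exp_smul_apply_le (A := -Q.yosida l) (fun g => by
    rw [neg_apply, inner_neg_left]
    linarith [hQ.inner_yosida_self_nonneg hl g]) ht f
  simpa using this

/-- On the range of `(L + 1)⁻¹` the Yosida approximations converge, as
`λ L (L + λ)⁻¹ (L + 1)⁻¹ g = λ (L + λ)⁻¹ (g - (L + 1)⁻¹ g)`. -/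
theorem tendsto_yosida_resolvent (hQ : Q.IsNonnegClosed) (g : H) :
    Tendsto (fun n : ℕ => Q.yosida n (Q.resolvent 1 g)) atTop (𝓝 (g - Q.resolvent 1 g)) := by
  refine (hQ.tendsto_smul_resolvent (g - Q.resolvent 1 g)).congr' ?_
  filter_upwards [eventually_gt_atTop 0] with n hn
  have hn0 : (0 : ℝ) < n := by exact_mod_cast hn
  change _ = (n : ℝ) • (Q.resolvent 1 g - (n : ℝ) • Q.resolvent n (Q.resolvent 1 g))
  congr 1
  have h := hQ.resolvent_sub hn0 one_pos g
  rw [map_sub]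
  linear_combination (norm := module) h

/-- The limit defining the semigroup exists. -/
theorem tendsto_exp_yosida [CompleteSpace H] (hQ : Q.IsNonnegClosed) {t : ℝ} (ht : 0 ≤ t) (f : H) :
    Tendsto (fun n : ℕ => NormedSpace.exp ((-t) • Q.yosida n) f) atTop (𝓝 (Q.semigroup t f)) := by
  refine CauchySeq.tendsto_limUnder ?_
  rw [Metric.cauchySeq_iff']
  intro ε hε
  set δ := ε / 4 with hδ
  have hδ0 : 0 < δ := by positivity
  obtain ⟨k, hk⟩ : ∃ k : ℕ, 0 < k ∧ ‖(k : ℝ) • Q.resolvent k f - f‖ < δ := by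
    have := (Metric.tendsto_nhds.1 (hQ.tendsto_smul_resolvent f) δ hδ0).and (eventually_gt_atTop 0)
    obtain ⟨k, h1, h2⟩ := this.exists
    exact ⟨k, h2, by rwa [← dist_eq_norm]⟩
  have hk0 : (0 : ℝ) < k := by exact_mod_cast hk.1
  -- every `(L + k)⁻¹ f` lies in the range of `(L + 1)⁻¹`, by the resolvent identity
  set h : H := (k : ℝ) • Q.resolvent k f with hh
  obtain ⟨g, hg⟩ : ∃ g, h = Q.resolvent 1 g := by
    refine ⟨(k : ℝ) • (f + (1 - (k : ℝ)) • Q.resolvent k f), ?_⟩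
    have := hQ.resolvent_sub one_pos hk0 f
    rw [hh, map_smul, map_add, map_smul]
    congr 1
    linear_combination (norm := module) -this
  have hc := (hQ.tendsto_yosida_resolvent g).cauchySeq
  rw [← hg, Metric.cauchySeq_iff] at hc
  obtain ⟨N, hN⟩ := hc (δ / (t + 1)) (by positivity)
  refine ⟨N + 1, fun n hn => ?_⟩
  have hn0 : (0 : ℝ) < n := by exact_mod_cast (Nat.succ_pos N).trans_le hn
  have hN0 : (0 : ℝ) < (N + 1 : ℕ) := by exact_mod_cast Nat.succ_pos N
  set E : ℕ → H →L[ℝ] H := fun n => NormedSpace.exp ((-t) • Q.yosida n) with hE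
  change dist (E n f) (E (N + 1) f) < ε
  have hdis : ∀ {l : ℝ}, 0 < l → ∀ g, inner ℝ (((-t) • Q.yosida l) g) g ≤ 0 := by
    intro l hl g
    rw [smul_apply, real_inner_smul_left]
    nlinarith [hQ.inner_yosida_self_nonneg hl g]
  have h1 : ‖E n h - E (N + 1) h‖ ≤ δ := by
    refine (BoundedExp.norm_exp_apply_sub_le
      (((hQ.yosida_commute hn0 hN0).smul_left _).smul_right _) (hdis hn0) (hdis hN0) h).trans ?_
    rw [smul_apply, smul_apply, ← smul_sub, norm_smul, norm_neg, Real.norm_of_nonneg ht,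
      ← dist_eq_norm]
    have h2 := (hN n (by omega) (N + 1) (by omega)).le
    calc t * _ ≤ (t + 1) * (δ / (t + 1)) := by gcongr; linarith
      _ = δ := by field_simp
  have h3 : ‖E n (h - f)‖ ≤ δ := (hQ.norm_exp_yosida_apply_le hn0 ht _).trans hk.2.le
  have h4 : ‖E (N + 1) (h - f)‖ ≤ δ := (hQ.norm_exp_yosida_apply_le hN0 ht _).trans hk.2.le
  have h5 : E n f - E (N + 1) f = E n h - E (N + 1) h - E n (h - f) + E (N + 1) (h - f) := by
    rw [map_sub, map_sub]; abel
  rw [dist_eq_norm, h5]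
  have h6 := norm_add_le (E n h - E (N + 1) h - E n (h - f)) (E (N + 1) (h - f))
  have h7 := norm_sub_le (E n h - E (N + 1) h) (E n (h - f))
  linarith

/-- The transience estimate. If `⟨v, d⟩² ≤ c Q(v)` on the form domain, then the Yosida
approximations `Y` satisfy such an inequality with a constant independent of `λ ≥ 1`. -/
theorem inner_sq_le_inner_yosida (hQ : Q.IsNonnegClosed) {c : ℝ} {d : H}
    (hc : ∀ v : Q.dom, (inner ℝ (v : H) d) ^ 2 ≤ c * Q.form v v) {l : ℝ} (hl : 1 ≤ l) (w : H) :
    (inner ℝ w d) ^ 2 ≤ (2 * (|c| + ‖d‖ ^ 2)) * inner ℝ (Q.yosida l w) w := by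
  have hl0 : 0 < l := by linarith
  rw [hQ.inner_yosida_self hl0]
  set v : Q.dom := l • ⟨_, hQ.resolvent_mem hl0 w⟩ with hv
  set y := Q.yosida l w with hy
  have hw : w = (v : H) + l⁻¹ • y := by
    have : y = l • (w - v) := rfl
    rw [this, smul_smul, inv_mul_cancel₀ hl0.ne', one_smul]
    abel
  have h1 := hc v
  have h2 : (inner ℝ y d) ^ 2 ≤ ‖y‖ ^ 2 * ‖d‖ ^ 2 := by
    rw [← mul_pow, sq_le_sq, abs_of_nonneg (by positivity : 0 ≤ ‖y‖ * ‖d‖)]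
    exact abs_real_inner_le_norm _ _
  have h3 : inner ℝ w d = inner ℝ (v : H) d + l⁻¹ * inner ℝ y d := by
    conv_lhs => rw [hw, inner_add_left, real_inner_smul_left]
  have h4 : l⁻¹ ≤ 1 := inv_le_one_of_one_le₀ hl
  have h5 : 0 ≤ l⁻¹ := by positivity
  have hQv := hQ.nonneg v
  have h6 : (l⁻¹ * inner ℝ y d) ^ 2 ≤ ‖d‖ ^ 2 * (l⁻¹ * ‖y‖ ^ 2) := by
    calc (l⁻¹ * inner ℝ y d) ^ 2 = l⁻¹ * (l⁻¹ * (inner ℝ y d) ^ 2) := by ring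
      _ ≤ 1 * (l⁻¹ * (‖y‖ ^ 2 * ‖d‖ ^ 2)) := by gcongr
      _ = _ := by ring
  have h7 : c * Q.form v v ≤ |c| * Q.form v v := by gcongr; exact le_abs_self c
  rw [h3]
  calc (inner ℝ (v : H) d + l⁻¹ * inner ℝ y d) ^ 2
      ≤ 2 * (inner ℝ (v : H) d) ^ 2 + 2 * (l⁻¹ * inner ℝ y d) ^ 2 := by
        nlinarith [sq_nonneg (inner ℝ (v : H) d - l⁻¹ * inner ℝ y d)]
    _ ≤ 2 * (|c| * Q.form v v) + 2 * (‖d‖ ^ 2 * (l⁻¹ * ‖y‖ ^ 2)) := by gcongr; linarith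
    _ ≤ _ := by
      have : 0 ≤ |c| * (l⁻¹ * ‖y‖ ^ 2) := by positivity
      have : 0 ≤ ‖d‖ ^ 2 * Q.form v v := by positivity
      linarith

/-- Under the transience inequality the Green function at `d` is finite: the time integrals of the
Yosida semigroups are bounded uniformly, and Fatou's lemma applies. -/
theorem lintegral_inner_semigroup_lt_top [CompleteSpace H] (hQ : Q.IsNonnegClosed) {c : ℝ} {d : H}
    (hc : ∀ v : Q.dom, (inner ℝ (v : H) d) ^ 2 ≤ c * Q.form v v) :
    ∫⁻ t in Set.Ioi (0 : ℝ), ENNReal.ofReal (inner ℝ (Q.semigroup t d) d) < ⊤ := by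
  set C := 2 * (|c| + ‖d‖ ^ 2) with hC
  set F : ℕ → ℝ → ℝ := fun n t => inner ℝ (NormedSpace.exp ((-t) • Q.yosida n) d) d with hF
  have hFc : ∀ n, Continuous (F n) := by
    intro n
    have := (BoundedExp.continuous_exp_smul_apply (Q.yosida n) d).comp continuous_neg
    exact this.inner continuous_const
  have hF0 : ∀ n : ℕ, 0 < n → ∀ t, 0 ≤ F n t := fun n hn t =>
    BoundedExp.inner_exp_smul_apply_self_nonneg
      (hQ.isSelfAdjoint_yosida (by exact_mod_cast hn)) _ _
  have hbound : ∀ n : ℕ, 0 < n →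
      ∫⁻ t in Set.Ioi (0 : ℝ), ENNReal.ofReal (F n t) ≤ ENNReal.ofReal C := by
    intro n hn
    have hn1 : (1 : ℝ) ≤ n := by exact_mod_cast hn
    have hIoi : Set.Ioi (0 : ℝ) = ⋃ k : ℕ, Set.Ioc (0 : ℝ) k := by
      ext t
      simp only [Set.mem_Ioi, Set.mem_iUnion, Set.mem_Ioc, exists_and_left]
      exact ⟨fun h => ⟨h, exists_nat_ge t⟩, fun h => h.1⟩
    rw [hIoi, setLIntegral_iUnion_of_directed]
    · refine iSup_le fun k => ?_
      rw [← ofReal_integral_eq_lintegral_ofReal (((hFc n).integrableOn_Icc).mono_set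
        Set.Ioc_subset_Icc_self) (Eventually.of_forall (hF0 n hn)),
        ← intervalIntegral.integral_of_le k.cast_nonneg]
      exact ENNReal.ofReal_le_ofReal (BoundedExp.integral_inner_exp_le
        (hQ.isSelfAdjoint_yosida (by linarith)) d (hQ.inner_sq_le_inner_yosida hc hn1)
        (by positivity) k.cast_nonneg)
    · refine Monotone.directed_le fun i j hij => Set.Ioc_subset_Ioc_right ?_
      exact_mod_cast hij
  calc ∫⁻ t in Set.Ioi (0 : ℝ), ENNReal.ofReal (inner ℝ (Q.semigroup t d) d)
      = ∫⁻ t in Set.Ioi (0 : ℝ), liminf (fun n => ENNReal.ofReal (F n t)) atTop := by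
        refine setLIntegral_congr_fun measurableSet_Ioi fun t ht => ?_
        have := (hQ.tendsto_exp_yosida (le_of_lt ht) d).inner (𝕜 := ℝ) (tendsto_const_nhds (x := d))
        exact (ENNReal.tendsto_ofReal this).liminf_eq.symm
    _ ≤ liminf (fun n => ∫⁻ t in Set.Ioi (0 : ℝ), ENNReal.ofReal (F n t)) atTop :=
        lintegral_liminf_le fun n => (hFc n).measurable.ennreal_ofReal
    _ ≤ ENNReal.ofReal C := by
        refine liminf_le_of_le (by isBoundedDefault) fun b hb => ?_
        obtain ⟨n, hn, hn'⟩ := (hb.and (eventually_gt_atTop 0)).exists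
        exact hn.trans (hbound n hn')
    _ < ⊤ := ENNReal.ofReal_lt_top

end IsNonnegClosed
end PartialForm

variable {V : Type*}

/-! ### Point evaluations and density in `ℓ²(V, m)` -/

namespace Ell2

variable {m : VertexMeasure V}

theorem inner_delta (u : Ell2 m) (x : V) : inner ℝ u (delta m x) = u x * m.weight x := by
  classical
  rw [inner_eq, tsum_eq_single x]
  · simp [delta]
  · intro y hy
    simp [delta, hy]

theorem norm_sq_eq (u : Ell2 m) : ‖u‖ ^ 2 = ∑' x, u x ^ 2 * m.weight x := by
  rw [← real_inner_self_eq_norm_sq, inner_eq]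
  exact tsum_congr fun x => by ring

theorem continuous_apply (x : V) : Continuous fun u : Ell2 m => u x := by
  have h : (fun u : Ell2 m => u x) = fun u => inner ℝ u (delta m x) / m.weight x := by
    ext u
    rw [inner_delta, mul_div_cancel_right₀ _ (m.pos x).ne']
  rw [h]
  exact (continuous_id.inner continuous_const).div_const _

theorem dense_of_delta_mem {D : Submodule ℝ (Ell2 m)} (h : ∀ x, delta m x ∈ D) :
    Dense (D : Set (Ell2 m)) := by
  rw [Submodule.dense_iff_topologicalClosure_eq_top, Submodule.topologicalClosure_eq_top_iff,
    Submodule.eq_bot_iff]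
  intro u hu
  ext x
  have h1 := (Submodule.mem_orthogonal' D u).1 hu _ (h x)
  rw [inner_delta] at h1
  exact (mul_eq_zero.1 h1).resolve_right (m.pos x).ne'

/-- Functions of finite support are square summable. -/
theorem summable_of_finite_support (m : VertexMeasure V) {u : V → ℝ}
    (hu : (Function.support u).Finite) : Summable fun x => u x ^ 2 * m.weight x :=
  summable_of_hasFiniteSupport <| hu.subset fun x hx => by
    by_contra h
    simp [Function.notMem_support.1 h] at hx

end Ell2

namespace WeightedGraph

variable (G : WeightedGraph V)

/-! ### The edge energy of a function -/

/-- Finiteness of `∑ b(x,y) (u(x) - u(y))²`. -/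
def EdgeSummable (u : V → ℝ) : Prop :=
  Summable fun p : V × V => G.b p.1 p.2 * (u p.1 - u p.2) ^ 2

/-- The sum `∑ b(x,y) (u(x) - u(y))²` over ordered pairs, twice the energy of `u` when there is no
potential. -/
def edgeSum (u : V → ℝ) : ℝ := ∑' p : V × V, G.b p.1 p.2 * (u p.1 - u p.2) ^ 2

variable {G}

theorem edge_nonneg (u : V → ℝ) (p : V × V) : 0 ≤ G.b p.1 p.2 * (u p.1 - u p.2) ^ 2 :=
  mul_nonneg (G.b_nonneg _ _) (sq_nonneg _)

theorem edgeSum_nonneg (u : V → ℝ) : 0 ≤ G.edgeSum u := tsum_nonneg (edge_nonneg u)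

theorem EdgeSummable.of_contraction {u v : V → ℝ} (hu : G.EdgeSummable u)
    (h : ∀ x y, (v x - v y) ^ 2 ≤ (u x - u y) ^ 2) : G.EdgeSummable v :=
  Summable.of_nonneg_of_le (edge_nonneg v)
    (fun p => mul_le_mul_of_nonneg_left (h p.1 p.2) (G.b_nonneg _ _)) hu

theorem edgeSum_le_of_contraction {u v : V → ℝ} (hu : G.EdgeSummable u)
    (h : ∀ x y, (v x - v y) ^ 2 ≤ (u x - u y) ^ 2) : G.edgeSum v ≤ G.edgeSum u :=
  (hu.of_contraction h).tsum_le_tsum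
    (fun p => mul_le_mul_of_nonneg_left (h p.1 p.2) (G.b_nonneg _ _)) hu

theorem edge_le_edgeSum {u : V → ℝ} (hu : G.EdgeSummable u) (x y : V) :
    G.b x y * (u x - u y) ^ 2 ≤ G.edgeSum u :=
  hu.le_tsum (x, y) fun p _ => edge_nonneg u p

/-- Functions of finite support have finite energy, as `∑ b(x, ·)` is finite at every vertex. -/
theorem EdgeSummable.of_finite_support {u : V → ℝ} (hu : (Function.support u).Finite) :
    G.EdgeSummable u := by
  have h1 : Summable fun p : V × V => G.b p.1 p.2 * u p.1 ^ 2 := by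
    have h0 : 0 ≤ fun p : V × V => G.b p.1 p.2 * u p.1 ^ 2 :=
      fun p => mul_nonneg (G.b_nonneg _ _) (sq_nonneg _)
    have h1 : ∀ x, Summable fun y => G.b x y * u x ^ 2 :=
      fun x => (G.b_summable x).mul_right (u x ^ 2)
    have h2 : Summable fun x => ∑' y, G.b x y * u x ^ 2 := by
      refine summable_of_hasFiniteSupport (hu.subset fun x hx => ?_)
      by_contra h
      simp [Function.notMem_support.1 h] at hx
    exact (summable_prod_of_nonneg h0).2 ⟨h1, h2⟩
  have h2 : Summable fun p : V × V => G.b p.1 p.2 * u p.2 ^ 2 := by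
    rw [← (Equiv.prodComm V V).summable_iff]
    exact h1.congr fun p => by simp [G.b_symm p.1 p.2]
  refine Summable.of_nonneg_of_le (edge_nonneg u) (fun p => ?_) ((h1.add h2).mul_left 2)
  have := mul_le_mul_of_nonneg_left
    (show (u p.1 - u p.2) ^ 2 ≤ 2 * u p.1 ^ 2 + 2 * u p.2 ^ 2 by
      nlinarith [sq_nonneg (u p.1 + u p.2)]) (G.b_nonneg p.1 p.2)
  linarith

/-! ### The Neumann and the regular form in the absence of a potential -/

variable {m : VertexMeasure V}

theorem mem_finiteEnergy_iff (hc : G.c = 0) {u : V → ℝ} :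
    u ∈ G.finiteEnergy ↔ G.EdgeSummable u :=
  ⟨fun h => h.1, fun h => ⟨h, by simp [hc, summable_zero]⟩⟩

theorem mem_neumannForm_dom_iff (hc : G.c = 0) {u : Ell2 m} :
    u ∈ (G.neumannForm m).dom ↔ G.EdgeSummable u := mem_finiteEnergy_iff hc

theorem formNormSq_eq (hc : G.c = 0) (u : (G.neumannForm m).dom) :
    G.formNormSq m u = (1 / 2) * G.edgeSum (u : Ell2 m) + ‖(u : Ell2 m)‖ ^ 2 := by
  rw [formNormSq, neumannForm_apply, energy_apply, hc, edgeSum]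
  simp [pow_two]

theorem mem_regularDomain_of_finite_support (hc : G.c = 0) {u : Ell2 m}
    (hu : (Function.support u).Finite) : u ∈ G.regularDomain m := by
  have h := (mem_neumannForm_dom_iff (m := m) hc).2 (EdgeSummable.of_finite_support hu)
  refine ⟨h, fun _ => ⟨u, h⟩, fun _ => hu, ?_⟩
  simp [formNormSq]

/-- The domain of the regular form is closed in the form norm. -/
theorem mem_regularDomain_of_approx {u : (G.neumannForm m).dom}
    (h : ∀ ε > 0, ∃ v : (G.neumannForm m).dom, (v : Ell2 m) ∈ G.regularDomain m ∧
      G.formNormSq m (u - v) < ε) : (u : Ell2 m) ∈ G.regularDomain m := by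
  have key : ∀ n : ℕ, ∃ φ : (G.neumannForm m).dom, (Function.support (φ : Ell2 m)).Finite ∧
      G.formNormSq m (u - φ) < 1 / ((n : ℝ) + 1) := by
    intro n
    obtain ⟨v, ⟨hv, φ, hφ, hlim⟩, hv'⟩ := h (1 / ((n : ℝ) + 1) / 4) (by positivity)
    obtain ⟨k, hk⟩ := (hlim.eventually_lt_const
      (show (0 : ℝ) < 1 / ((n : ℝ) + 1) / 4 by positivity)).exists
    refine ⟨φ k, hφ k, ?_⟩
    have h1 := G.formNormSq_add_le m (u - v) (v - φ k)
    rw [sub_add_sub_cancel] at h1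
    linarith
  choose φ hφ hlt using key
  refine ⟨u.2, φ, hφ, squeeze_zero (fun n => G.formNormSq_nonneg m _) (fun n => (hlt n).le) ?_⟩
  exact tendsto_one_div_add_atTop_nhds_zero_nat

theorem norm_sqrt_mul_rpow {b : ℝ} (hb : 0 ≤ b) (d : ℝ) :
    ‖√(b / 2) * d‖ ^ (2 : ENNReal).toReal = 1 / 2 * (b * d ^ 2) := by
  rw [ENNReal.toReal_ofNat, Real.rpow_ofNat, Real.norm_eq_abs, sq_abs, mul_pow,
    Real.sq_sqrt (by positivity)]
  ring

variable (G) in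
/-- The weighted difference operator `u ↦ √(b(x,y)/2) (u(x) - u(y))` into `ℓ²(V × V)`. -/
def gradient : G.finiteEnergy →ₗ[ℝ] lp (fun _ : V × V => ℝ) 2 where
  toFun u := ⟨fun p => √(G.b p.1 p.2 / 2) * (u.1 p.1 - u.1 p.2), by
    apply memℓp_gen
    exact (u.2.1.mul_left (1 / 2)).congr fun p => (norm_sqrt_mul_rpow (G.b_nonneg _ _) _).symm⟩
  map_add' u v := by
    ext p
    change √(G.b p.1 p.2 / 2) * (u.1 p.1 + v.1 p.1 - (u.1 p.2 + v.1 p.2)) =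
      √(G.b p.1 p.2 / 2) * (u.1 p.1 - u.1 p.2) + √(G.b p.1 p.2 / 2) * (v.1 p.1 - v.1 p.2)
    ring
  map_smul' a u := by
    ext p
    change √(G.b p.1 p.2 / 2) * (a * u.1 p.1 - a * u.1 p.2) =
      a * (√(G.b p.1 p.2 / 2) * (u.1 p.1 - u.1 p.2))
    ring

theorem gradient_apply (u : G.finiteEnergy) (p : V × V) :
    G.gradient u p = √(G.b p.1 p.2 / 2) * (u.1 p.1 - u.1 p.2) := rfl

theorem energy_eq_inner_gradient (hc : G.c = 0) (u v : G.finiteEnergy) :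
    G.energy u v = inner ℝ (G.gradient u) (G.gradient v) := by
  rw [energy_apply, lp.inner_eq_tsum, hc, ← tsum_mul_left]
  simp only [Pi.zero_apply, zero_mul, tsum_zero, add_zero]
  refine tsum_congr fun p => ?_
  have h := Real.mul_self_sqrt (show 0 ≤ G.b p.1 p.2 / 2 from
    div_nonneg (G.b_nonneg _ _) zero_le_two)
  simp only [gradient_apply, RCLike.inner_apply, conj_trivial]
  linear_combination (-(u.1 p.1 - u.1 p.2) * (v.1 p.1 - v.1 p.2)) * h

/-- The gradient on the domain of the Neumann form. -/
def neumannGradient (G : WeightedGraph V) (m : VertexMeasure V) :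
    (G.neumannForm m).dom →ₗ[ℝ] lp (fun _ : V × V => ℝ) 2 :=
  G.gradient ∘ₗ Ell2.toFun.restrict fun _ h => h

theorem neumannForm_eq_inner (hc : G.c = 0) (u v : (G.neumannForm m).dom) :
    (G.neumannForm m).form u v = inner ℝ (G.neumannGradient m u) (G.neumannGradient m v) :=
  energy_eq_inner_gradient hc _ _

theorem formNormSq_eq_norm (hc : G.c = 0) (u : (G.neumannForm m).dom) :
    G.formNormSq m u = ‖G.neumannGradient m u‖ ^ 2 + ‖(u : Ell2 m)‖ ^ 2 := by
  rw [formNormSq, neumannForm_eq_inner hc, real_inner_self_eq_norm_sq]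

/-- A function whose differences are given by a square summable function on the edges has finite
energy. -/
theorem edgeSummable_of_lp {u : V → ℝ} (h : lp (fun _ : V × V => ℝ) 2)
    (hu : ∀ p : V × V, √(G.b p.1 p.2 / 2) * (u p.1 - u p.2) = h p) : G.EdgeSummable u := by
  have h1 := (memℓp_gen_iff (by norm_num)).1 h.2
  refine (h1.mul_left 2).congr fun p => ?_
  rw [← hu, norm_sqrt_mul_rpow (G.b_nonneg _ _)]
  ring

theorem isClosed_graph_gradient (hc : G.c = 0) : IsClosed {p : Ell2 m × lp (fun _ : V × V => ℝ) 2 |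
    ∃ h : p.1 ∈ (G.regularForm m).dom, (G.neumannGradient m ∘ₗ
      Submodule.inclusion (G.regularDomain_le m)) ⟨p.1, h⟩ = p.2} := by
  refine isClosed_of_closure_subset fun ⟨u, h⟩ hp => ?_
  obtain ⟨q, hq, hlim⟩ := mem_closure_iff_seq_limit.1 hp
  choose hd hT using hq
  rw [nhds_prod_eq] at hlim
  have hl1 : Tendsto (fun n => (q n).1) atTop (𝓝 u) := hlim.fst
  have hl2 : Tendsto (fun n => (q n).2) atTop (𝓝 h) := hlim.snd
  have hpt : ∀ p : V × V, √(G.b p.1 p.2 / 2) * (u p.1 - u p.2) = h p := by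
    intro p
    have a1 : Tendsto (fun n => √(G.b p.1 p.2 / 2) * ((q n).1 p.1 - (q n).1 p.2)) atTop
        (𝓝 (√(G.b p.1 p.2 / 2) * (u p.1 - u p.2))) :=
      ((((Ell2.continuous_apply p.1).tendsto u).comp hl1).sub
        (((Ell2.continuous_apply p.2).tendsto u).comp hl1)).const_mul _
    have a2 : Tendsto (fun n => (q n).2 p) atTop (𝓝 (h p)) := by
      rw [tendsto_iff_norm_sub_tendsto_zero] at hl2 ⊢
      exact squeeze_zero (fun n => norm_nonneg _)
        (fun n => lp.norm_apply_le_norm two_ne_zero ((q n).2 - h) p) hl2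
    refine tendsto_nhds_unique a1 (a2.congr fun n => ?_)
    rw [← hT n]
    rfl
  have hu : u ∈ (G.neumannForm m).dom :=
    (mem_neumannForm_dom_iff hc).2 (edgeSummable_of_lp h hpt)
  have hTu : G.neumannGradient m ⟨u, hu⟩ = h := by
    ext p
    exact hpt p
  have hmem : u ∈ G.regularDomain m := by
    refine mem_regularDomain_of_approx (u := ⟨u, hu⟩) fun ε hε => ?_
    have b1 : Tendsto (fun n => ‖h - (q n).2‖ ^ 2 + ‖u - (q n).1‖ ^ 2) atTop (𝓝 0) := by
      have c1 := ((tendsto_const_nhds (x := h)).sub hl2).norm.pow 2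
      have c2 := ((tendsto_const_nhds (x := u)).sub hl1).norm.pow 2
      simpa using c1.add c2
    obtain ⟨n, hn⟩ := (b1.eventually_lt_const hε).exists
    refine ⟨⟨(q n).1, (hd n).1⟩, hd n, ?_⟩
    rw [formNormSq_eq_norm hc, map_sub, hTu]
    have : G.neumannGradient m ⟨(q n).1, (hd n).1⟩ = (q n).2 := hT n
    rw [this]
    exact hn
  exact ⟨hmem, hTu⟩

theorem delta_mem_regularDomain (hc : G.c = 0) (x : V) : Ell2.delta m x ∈ G.regularDomain m :=
  mem_regularDomain_of_finite_support hc <| (Set.finite_singleton x).subset fun y hy => by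
    classical
    by_contra h
    have h' : y ≠ x := h
    simp [Ell2.delta, h'] at hy

theorem regularForm_apply (u v : (G.regularForm m).dom) :
    (G.regularForm m).form u v = (G.neumannForm m).form
      (Submodule.inclusion (G.regularDomain_le m) u)
      (Submodule.inclusion (G.regularDomain_le m) v) := rfl

theorem regularForm_isNonnegClosed (hc : G.c = 0) : (G.regularForm m).IsNonnegClosed := by
  have hd : Dense ((G.regularForm m).dom : Set (Ell2 m)) :=
    Ell2.dense_of_delta_mem (delta_mem_regularDomain hc)
  refine ⟨hd, fun u v => ?_, fun u => G.neumannForm_nonneg m _, fun α hα => ?_⟩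
  · rw [regularForm_apply, regularForm_apply, neumannForm_eq_inner hc, neumannForm_eq_inner hc,
      real_inner_comm]
  · exact PartialForm.exists_isResolvent_of_closed hd _
      (fun u v => by rw [regularForm_apply, neumannForm_eq_inner hc]; rfl)
      (isClosed_graph_gradient hc) hα

/-! ### Truncation -/

/-- Truncation of a real number to the interval `[lo, hi]`. -/
def clamp (lo hi a : ℝ) : ℝ := max lo (min hi a)

theorem clamp_le_clamp (lo hi : ℝ) {a b : ℝ} (h : a ≤ b) : clamp lo hi a ≤ clamp lo hi b :=
  max_le_max le_rfl (min_le_min le_rfl h)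

theorem clamp_sub_clamp_le (lo hi : ℝ) {a b : ℝ} (h : a ≤ b) :
    clamp lo hi b - clamp lo hi a ≤ b - a := by
  simp only [clamp]
  rcases max_cases lo (min hi a) with h1 | h1 <;> rcases max_cases lo (min hi b) with h2 | h2 <;>
  rcases min_cases hi a with h3 | h3 <;> rcases min_cases hi b with h4 | h4 <;> linarith

/-- The truncated part and the remaining part of a number both increase with the number. -/
theorem clamp_sub_mul_sub_clamp_nonneg (lo hi a b : ℝ) :
    0 ≤ (clamp lo hi a - clamp lo hi b) * (a - clamp lo hi a - (b - clamp lo hi b)) := by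
  rcases le_total a b with h | h
  · refine mul_nonneg_of_nonpos_of_nonpos ?_ ?_
    · linarith [clamp_le_clamp lo hi h]
    · linarith [clamp_sub_clamp_le lo hi h]
  · refine mul_nonneg ?_ ?_
    · linarith [clamp_le_clamp lo hi h]
    · linarith [clamp_sub_clamp_le lo hi h]

theorem sq_clamp_sub_clamp_le (lo hi a b : ℝ) :
    (clamp lo hi a - clamp lo hi b) ^ 2 ≤ (a - b) ^ 2 := by
  nlinarith [clamp_sub_mul_sub_clamp_nonneg lo hi a b,
    sq_nonneg (a - clamp lo hi a - (b - clamp lo hi b))]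

theorem sq_sub_clamp_sub_le (lo hi a b : ℝ) :
    (a - clamp lo hi a - (b - clamp lo hi b)) ^ 2 ≤ (a - b) ^ 2 := by
  nlinarith [clamp_sub_mul_sub_clamp_nonneg lo hi a b, sq_nonneg (clamp lo hi a - clamp lo hi b)]

/-! ### Recurrence yields finitely supported functions of small energy converging to `1` -/

/-- For a recurrent form there is no inequality `⟨v, δ_x⟩² ≤ c Q(v)`. -/
theorem exists_lt_inner_delta_sq (hc : G.c = 0) (hrec : (G.regularForm m).IsRecurrent) (x : V)
    (c : ℝ) : ∃ v : (G.regularForm m).dom,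
      c * (G.regularForm m).form v v < (inner ℝ (v : Ell2 m) (Ell2.delta m x)) ^ 2 := by
  by_contra! hcon
  have h := (regularForm_isNonnegClosed (m := m) hc).lintegral_inner_semigroup_lt_top hcon
  have hx := hrec x x
  have hm := m.pos x
  simp only [Ell2.inner_delta, ENNReal.ofReal_mul' hm.le] at h
  rw [lintegral_mul_const' _ _ ENNReal.ofReal_ne_top, hx,
    ENNReal.top_mul (by simpa using hm)] at h
  exact lt_irrefl _ h

/-- By density in the form norm, the functions violating the inequality can be chosen finitely
supported. -/
theorem exists_finite_support_lt (hc : G.c = 0) (hrec : (G.regularForm m).IsRecurrent) (x : V)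
    (c : ℝ) : ∃ φ : V → ℝ, (Function.support φ).Finite ∧
      c * G.edgeSum φ < φ x ^ 2 := by
  by_contra! hcon
  have hm := m.pos x
  -- `2` turns the edge sum into the energy, and `⟨v, δ_x⟩ = v x * m x`
  obtain ⟨v, hv⟩ := exists_lt_inner_delta_sq hc hrec x (2 * c * m.weight x ^ 2)
  obtain ⟨hvN, φ, hφ, hlim⟩ := v.2
  refine hv.not_ge ?_
  set T := G.neumannGradient m
  have hQ : (G.regularForm m).form v v = ‖T ⟨v, hvN⟩‖ ^ 2 := by
    rw [← real_inner_self_eq_norm_sq, ← neumannForm_eq_inner hc]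
    rfl
  simp only [formNormSq_eq_norm hc, map_sub] at hlim
  have l1 : Tendsto (fun n => T (φ n)) atTop (𝓝 (T ⟨v, hvN⟩)) := by
    rw [tendsto_iff_norm_sub_tendsto_zero]
    have : Tendsto (fun n => ‖T ⟨v, hvN⟩ - T (φ n)‖ ^ 2) atTop (𝓝 0) :=
      squeeze_zero (fun n => sq_nonneg _) (fun n => le_add_of_nonneg_right (sq_nonneg _)) hlim
    have := this.sqrt
    simpa [norm_sub_rev] using this
  have l2 : Tendsto (fun n => (φ n : Ell2 m)) atTop (𝓝 (v : Ell2 m)) := by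
    rw [tendsto_iff_norm_sub_tendsto_zero]
    have : Tendsto (fun n => ‖((⟨v, hvN⟩ - φ n : (G.neumannForm m).dom) : Ell2 m)‖ ^ 2) atTop
        (𝓝 0) :=
      squeeze_zero (fun n => sq_nonneg _) (fun n => le_add_of_nonneg_left (sq_nonneg _)) hlim
    have := this.sqrt
    simpa [norm_sub_rev] using this
  rw [hQ]
  have l3 : Tendsto (fun n => (inner ℝ (φ n : Ell2 m) (Ell2.delta m x)) ^ 2) atTop
      (𝓝 ((inner ℝ (v : Ell2 m) (Ell2.delta m x)) ^ 2)) :=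
    (l2.inner tendsto_const_nhds).pow 2
  refine le_of_tendsto_of_tendsto' l3 ((l1.norm.pow 2).const_mul _) fun n => ?_
  have h1 := hcon _ (hφ n)
  have h2 : G.edgeSum (φ n : Ell2 m) = 2 * ‖T (φ n)‖ ^ 2 := by
    have := formNormSq_eq hc (φ n)
    rw [formNormSq_eq_norm hc] at this
    linarith
  rw [h2] at h1
  rw [Ell2.inner_delta, mul_pow]
  nlinarith [sq_nonneg (m.weight x)]

/-- If the differences of `e n` have vanishing energy and `e n` is `1` at one vertex, then `e n`
converges to `1` along every path, hence everywhere on a connected graph. -/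
theorem tendsto_one_of_edgeSum (hconn : G.IsConnected) {e : ℕ → V → ℝ} {x : V}
    (hs : ∀ n, G.EdgeSummable (e n)) (hx : ∀ n, e n x = 1)
    (he : Tendsto (fun n => G.edgeSum (e n)) atTop (𝓝 0)) (y : V) :
    Tendsto (fun n => e n y) atTop (𝓝 1) := by
  induction hconn x y with
  | refl => simp [hx]
  | @tail v w _ hvw ih =>
    have h1 : Tendsto (fun n => (e n w - e n v) ^ 2) atTop (𝓝 0) := by
      have h2 := he.div_const (G.b v w)
      rw [zero_div] at h2
      refine squeeze_zero (fun n => sq_nonneg _) (fun n => ?_) h2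
      rw [le_div_iff₀ hvw]
      have := edge_le_edgeSum (hs n) v w
      nlinarith
    have h3 : Tendsto (fun n => e n w - e n v) atTop (𝓝 0) := by
      rw [tendsto_zero_iff_abs_tendsto_zero]
      have := h1.sqrt
      simpa [Real.sqrt_sq_eq_abs, Function.comp_def] using this
    simpa using h3.add ih

theorem exists_null_sequence [Nonempty V] (hc : G.c = 0) (hconn : G.IsConnected)
    (hrec : (G.regularForm m).IsRecurrent) :
    ∃ e : ℕ → V → ℝ, (∀ n, (Function.support (e n)).Finite) ∧ (∀ n x, 0 ≤ e n x) ∧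
      (∀ n x, e n x ≤ 1) ∧ Tendsto (fun n => G.edgeSum (e n)) atTop (𝓝 0) ∧
      ∀ x, Tendsto (fun n => e n x) atTop (𝓝 1) := by
  obtain ⟨x⟩ := ‹Nonempty V›
  -- normalise by the value at `x` and truncate; both operations keep the support finite
  choose φ hφ hlt using fun n : ℕ => exists_finite_support_lt hc hrec x ((n : ℝ) + 1)
  have hpos : ∀ n, 0 < φ n x ^ 2 := fun n =>
    (mul_nonneg (by positivity) (edgeSum_nonneg _)).trans_lt (hlt n)
  set e : ℕ → V → ℝ := fun n y => clamp 0 1 (φ n y / φ n x) with he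
  have hsupp : ∀ n, (Function.support (e n)).Finite := fun n =>
    (hφ n).subset fun y hy => by
      by_contra h
      simp [he, clamp, Function.notMem_support.1 h] at hy
  have hcontr : ∀ n y z, (e n y - e n z) ^ 2 ≤ (φ n y / φ n x - φ n z / φ n x) ^ 2 :=
    fun n y z => sq_clamp_sub_clamp_le _ _ _ _
  have hquot : ∀ n, (Function.support fun y => φ n y / φ n x).Finite := fun n =>
    (hφ n).subset fun y hy => by
      by_contra h
      simp [Function.notMem_support.1 h] at hy
  have hlim : Tendsto (fun n => G.edgeSum (e n)) atTop (𝓝 0) := by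
    refine squeeze_zero (fun n => edgeSum_nonneg _) (fun n => ?_)
      tendsto_one_div_add_atTop_nhds_zero_nat
    refine (edgeSum_le_of_contraction (EdgeSummable.of_finite_support (hquot n))
      (hcontr n)).trans ?_
    have h1 : G.edgeSum (fun y => φ n y / φ n x) = G.edgeSum (φ n) / φ n x ^ 2 := by
      rw [edgeSum, edgeSum, ← tsum_div_const]
      exact tsum_congr fun p => by rw [← sub_div, div_pow, mul_div_assoc]
    rw [h1, div_le_div_iff₀ (hpos n) (by positivity)]
    linarith [hlt n]
  refine ⟨e, hsupp, fun n y => le_max_left _ _, fun n y => max_le zero_le_one (min_le_left _ _),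
    hlim, tendsto_one_of_edgeSum hconn (fun n => EdgeSummable.of_finite_support (hsupp n))
      (x := x) (fun n => ?_) hlim⟩
  have : φ n x ≠ 0 := fun h => by simpa [h] using hpos n
  simp [he, clamp, this]

/-! ### Equality of the regular and the Neumann form -/

theorem formNormSq_sub_eq (hc : G.c = 0) (u v : (G.neumannForm m).dom) :
    G.formNormSq m (u - v) = (1 / 2) * G.edgeSum (fun x => (u : Ell2 m) x - (v : Ell2 m) x) +
      ∑' x, ((u : Ell2 m) x - (v : Ell2 m) x) ^ 2 * m.weight x := by
  rw [formNormSq_eq hc, Ell2.norm_sq_eq]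
  rfl

/-- A sequence of functions in the regular domain which converges pointwise to `u`, with
`|u - v n| ≤ |u|` as `ℓ²`-domination, and whose energy distance to `u` vanishes, forces `u` into the
domain. -/
theorem mem_regularDomain_of_tendsto (hc : G.c = 0) {u : Ell2 m}
    (hu : u ∈ (G.neumannForm m).dom) {v : ℕ → Ell2 m} (hv : ∀ n, v n ∈ G.regularDomain m)
    (hle : ∀ n x, |u x - v n x| ≤ |u x|)
    (hlim : ∀ x, Tendsto (fun n => v n x) atTop (𝓝 (u x)))
    (he : Tendsto (fun n => G.edgeSum (fun x => u x - v n x)) atTop (𝓝 0)) :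
    u ∈ G.regularDomain m := by
  have h1 : Tendsto (fun n => ∑' x, (u x - v n x) ^ 2 * m.weight x) atTop (𝓝 0) := by
    have := tendsto_tsum_of_dominated_convergence (𝓕 := atTop)
      (f := fun n x => (u x - v n x) ^ 2 * m.weight x) (g := fun _ => 0) u.summable
      (fun x => by
        have := ((((hlim x).const_sub (u x))).pow 2).mul_const (m.weight x)
        simpa using this)
      (Eventually.of_forall fun n x => by
        rw [Real.norm_of_nonneg (mul_nonneg (sq_nonneg _) (m.pos x).le)]
        exact mul_le_mul_of_nonneg_right (sq_le_sq.2 (hle n x)) (m.pos x).le)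
    simpa using this
  have h2 := (he.const_mul (1 / 2)).add h1
  rw [mul_zero, add_zero] at h2
  refine mem_regularDomain_of_approx (u := ⟨u, hu⟩) fun ε hε => ?_
  obtain ⟨n, hn⟩ := (h2.eventually_lt_const hε).exists
  refine ⟨⟨v n, (hv n).1⟩, hv n, ?_⟩
  rw [formNormSq_sub_eq hc]
  exact hn

/-- A bounded function `u` of finite energy is approximated by the finitely supported functions
`u e_n`: the difference of `u (1 - e_n)` along an edge `(x, y)` is
`(1 - e_n x) (u x - u y) - u y (e_n x - e_n y)`. -/
theorem mem_regularDomain_of_bounded (hc : G.c = 0) {e : ℕ → V → ℝ}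
    (hsupp : ∀ n, (Function.support (e n)).Finite) (h0 : ∀ n x, 0 ≤ e n x) (h1 : ∀ n x, e n x ≤ 1)
    (hE : Tendsto (fun n => G.edgeSum (e n)) atTop (𝓝 0))
    (hlim : ∀ x, Tendsto (fun n => e n x) atTop (𝓝 1)) {u : Ell2 m}
    (hu : u ∈ (G.neumannForm m).dom) {M : ℝ} (hM : ∀ x, |u x| ≤ M) : u ∈ G.regularDomain m := by
  have hs : ∀ n, (Function.support fun x => u x * e n x).Finite := fun n =>
    (hsupp n).subset fun x hx => right_ne_zero_of_mul hx
  have hues : G.EdgeSummable u := (mem_neumannForm_dom_iff hc).1 hu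
  have hes : ∀ n, G.EdgeSummable (e n) := fun n => EdgeSummable.of_finite_support (hsupp n)
  have hfac : ∀ n x, 0 ≤ 1 - e n x ∧ 1 - e n x ≤ 1 := fun n x =>
    ⟨by linarith [h1 n x], by linarith [h0 n x]⟩
  refine mem_regularDomain_of_tendsto hc hu
    (v := fun n => Ell2.mk (fun x => u x * e n x) (Ell2.summable_of_finite_support m (hs n)))
    (fun n => mem_regularDomain_of_finite_support hc (hs n)) (fun n x => ?_) (fun x => ?_) ?_
  · rw [Ell2.mk_apply, show u x - u x * e n x = u x * (1 - e n x) by ring, abs_mul,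
      abs_of_nonneg (hfac n x).1]
    exact mul_le_of_le_one_right (abs_nonneg _) (hfac n x).2
  · simpa using (hlim x).const_mul (u x)
  · simp only [Ell2.mk_apply]
    set A : ℕ → V × V → ℝ := fun n p =>
      G.b p.1 p.2 * ((1 - e n p.1) * (u p.1 - u p.2)) ^ 2 with hA
    have hAle : ∀ n p, A n p ≤ G.b p.1 p.2 * (u p.1 - u p.2) ^ 2 := by
      intro n p
      refine mul_le_mul_of_nonneg_left ?_ (G.b_nonneg _ _)
      rw [mul_pow]
      exact mul_le_of_le_one_left (sq_nonneg _) (pow_le_one₀ (hfac n p.1).1 (hfac n p.1).2)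
    have hA0 : ∀ n p, 0 ≤ A n p := fun n p => mul_nonneg (G.b_nonneg _ _) (sq_nonneg _)
    have hAs : ∀ n, Summable (A n) := fun n => Summable.of_nonneg_of_le (hA0 n) (hAle n) hues
    have hAlim : Tendsto (fun n => ∑' p, A n p) atTop (𝓝 0) := by
      have := tendsto_tsum_of_dominated_convergence (𝓕 := atTop)
        (f := A) (g := fun _ => 0) hues
        (fun p => by
          have := ((((hlim p.1).const_sub 1).mul_const (u p.1 - u p.2)).pow 2).const_mul
            (G.b p.1 p.2)
          simpa using this)
        (Eventually.of_forall fun n p => by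
          rw [Real.norm_of_nonneg (hA0 n p)]
          exact hAle n p)
      simpa using this
    have hB := (hAlim.const_mul 2).add (hE.const_mul (2 * M ^ 2))
    rw [mul_zero, mul_zero, add_zero] at hB
    refine squeeze_zero (fun n => edgeSum_nonneg _) (fun n => ?_) hB
    rw [edgeSum, edgeSum, ← tsum_mul_left, ← tsum_mul_left,
      ← ((hAs n).mul_left 2).tsum_add ((hes n).mul_left _)]
    have hterm : ∀ p : V × V, G.b p.1 p.2 *
        (u p.1 - u p.1 * e n p.1 - (u p.2 - u p.2 * e n p.2)) ^ 2 ≤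
        2 * A n p + 2 * M ^ 2 * (G.b p.1 p.2 * (e n p.1 - e n p.2) ^ 2) := by
      intro p
      have k1 : u p.2 ^ 2 ≤ M ^ 2 := sq_le_sq.2 ((hM p.2).trans (le_abs_self M))
      have k2 : (u p.1 - u p.1 * e n p.1 - (u p.2 - u p.2 * e n p.2)) ^ 2 ≤
          2 * ((1 - e n p.1) * (u p.1 - u p.2)) ^ 2 + 2 * (u p.2 ^ 2 * (e n p.1 - e n p.2) ^ 2) := by
        nlinarith [sq_nonneg ((1 - e n p.1) * (u p.1 - u p.2) + u p.2 * (e n p.1 - e n p.2))]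
      have k3 := mul_le_mul_of_nonneg_right k1 (sq_nonneg (e n p.1 - e n p.2))
      have k4 := mul_le_mul_of_nonneg_left (k2.trans (add_le_add_right
        (mul_le_mul_of_nonneg_left k3 zero_le_two) _)) (G.b_nonneg p.1 p.2)
      refine k4.trans (le_of_eq ?_)
      simp only [hA]
      ring
    have hsum := ((hAs n).mul_left 2).add ((hes n).mul_left (2 * M ^ 2))
    exact (Summable.of_nonneg_of_le (edge_nonneg fun x => u x - u x * e n x) hterm
      hsum).tsum_le_tsum hterm hsum

/-- Every function in the domain of the Neumann form is approximated by its truncations. -/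
theorem mem_regularDomain_of_clamp (hc : G.c = 0) {u : Ell2 m} (hu : u ∈ (G.neumannForm m).dom)
    (h : ∀ v ∈ (G.neumannForm m).dom, ∀ M : ℝ, (∀ x, |v x| ≤ M) → v ∈ G.regularDomain m) :
    u ∈ G.regularDomain m := by
  have hues : G.EdgeSummable u := (mem_neumannForm_dom_iff hc).1 hu
  have hk : ∀ (n : ℕ) (a : ℝ), |clamp (-n) n a| ≤ n ∧ |clamp (-n) n a| ≤ |a| ∧
      |a - clamp (-n) n a| ≤ |a| := by
    intro n a
    have := n.cast_nonneg (α := ℝ)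
    simp only [clamp]
    rcases max_cases (-(n : ℝ)) (min n a) with h1 | h1 <;>
    rcases min_cases (n : ℝ) a with h2 | h2 <;>
    rcases abs_cases a with h3 | h3 <;>
    refine ⟨abs_le.2 ⟨?_, ?_⟩, abs_le.2 ⟨?_, ?_⟩, abs_le.2 ⟨?_, ?_⟩⟩ <;> linarith
  have heq : ∀ (a : ℝ) (n : ℕ), |a| ≤ n → clamp (-n) n a = a := by
    intro a n h
    obtain ⟨h1, h2⟩ := abs_le.1 h
    rw [clamp, min_eq_right h2, max_eq_right h1]
  have hev : ∀ x, ∀ᶠ n : ℕ in atTop, clamp (-n) n (u x) = u x := fun x => by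
    filter_upwards [eventually_ge_atTop ⌈|u x|⌉₊] with n hn
    exact heq _ _ (Nat.ceil_le.1 hn)
  set v : ℕ → Ell2 m := fun n => Ell2.mk (fun x => clamp (-n) n (u x)) <|
    Summable.of_nonneg_of_le (fun x => mul_nonneg (sq_nonneg _) (m.pos x).le)
      (fun x => mul_le_mul_of_nonneg_right (sq_le_sq.2 (hk n (u x)).2.1) (m.pos x).le)
      u.summable with hv
  have hvx : ∀ n x, v n x = clamp (-n) n (u x) := fun n x => rfl
  refine mem_regularDomain_of_tendsto hc hu (v := v) (fun n => ?_) (fun n x => ?_) (fun x => ?_) ?_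
  · refine h _ ?_ n fun x => (hk n (u x)).1
    exact (mem_neumannForm_dom_iff hc).2
      (hues.of_contraction fun x y => sq_clamp_sub_clamp_le _ _ _ _)
  · exact (hk n (u x)).2.2
  · exact tendsto_const_nhds.congr' ((hev x).mono fun n hn => hn.symm)
  · simp only [edgeSum, hvx]
    have := tendsto_tsum_of_dominated_convergence (𝓕 := atTop)
      (f := fun (n : ℕ) (p : V × V) => G.b p.1 p.2 *
        (u p.1 - clamp (-n) n (u p.1) - (u p.2 - clamp (-n) n (u p.2))) ^ 2)
      (g := fun _ => 0) hues
      (fun p => by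
        refine tendsto_const_nhds.congr' ?_
        filter_upwards [hev p.1, hev p.2] with n h1 h2
        simp [h1, h2])
      (Eventually.of_forall fun n p => by
        rw [Real.norm_of_nonneg (mul_nonneg (G.b_nonneg _ _) (sq_nonneg _))]
        refine mul_le_mul_of_nonneg_left ?_ (G.b_nonneg _ _)
        exact sq_sub_clamp_sub_le _ _ _ _)
    simpa using this

theorem regularForm_eq_neumannForm_of_le (h : (G.neumannForm m).dom ≤ G.regularDomain m) :
    G.regularForm m = G.neumannForm m := by
  have key : ∀ (Q : PartialForm (Ell2 m)) (D : Submodule ℝ (Ell2 m)) (hD : D ≤ Q.dom),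
      Q.dom ≤ D → Q.restrict D hD = Q := by
    rintro ⟨D', B⟩ D hD hD'
    obtain rfl : D = D' := le_antisymm hD hD'
    rfl
  exact key _ _ _ h

/-! ### Stochastic completeness -/

theorem neumannForm_apply_of_potential_zero (hc : G.c = 0) (u v : (G.neumannForm m).dom) :
    (G.neumannForm m).form u v = (1 / 2) * ∑' p : V × V, G.b p.1 p.2 *
      (((u : Ell2 m) p.1 - (u : Ell2 m) p.2) * ((v : Ell2 m) p.1 - (v : Ell2 m) p.2)) := by
  rw [neumannForm_apply, energy_apply, hc]
  simp

/-- The resolvent of the Neumann form is Markovian: testing `L u + u = f` with the part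
`w = u - (0 ∨ u ∧ 1)` of `u` outside `[0, 1]` gives `0 ≤ Q(u, w) = ⟨f - u, w⟩ ≤ -‖w‖²`. -/
theorem resolvent_markov (hc : G.c = 0) (hQ : (G.neumannForm m).IsNonnegClosed) {f : Ell2 m}
    (h0 : ∀ x, 0 ≤ f x) (h1 : ∀ x, f x ≤ 1) (x : V) :
    0 ≤ (G.neumannForm m).resolvent 1 f x ∧ (G.neumannForm m).resolvent 1 f x ≤ 1 := by
  set u := (G.neumannForm m).resolvent 1 f with hu
  have hud := hQ.resolvent_mem one_pos f
  have hues : G.EdgeSummable u := (mem_neumannForm_dom_iff hc).1 hud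
  have habs : ∀ a : ℝ, (a - clamp 0 1 a) ^ 2 ≤ a ^ 2 := fun a => by
    simpa [clamp] using sq_sub_clamp_sub_le 0 1 a 0
  set w : Ell2 m := Ell2.mk (fun x => u x - clamp 0 1 (u x)) <|
    Summable.of_nonneg_of_le (fun x => mul_nonneg (sq_nonneg _) (m.pos x).le)
      (fun x => mul_le_mul_of_nonneg_right (habs (u x)) (m.pos x).le) u.summable with hw
  have hwx : ∀ x, w x = u x - clamp 0 1 (u x) := fun x => rfl
  have hwd : w ∈ (G.neumannForm m).dom := (mem_neumannForm_dom_iff hc).2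
    (hues.of_contraction fun x y => sq_sub_clamp_sub_le _ _ _ _)
  have heq := hQ.form_resolvent one_pos f ⟨w, hwd⟩
  have hnn : 0 ≤ (G.neumannForm m).form ⟨u, hud⟩ ⟨w, hwd⟩ := by
    rw [neumannForm_apply_of_potential_zero hc]
    refine mul_nonneg (by norm_num) (tsum_nonneg fun p => mul_nonneg (G.b_nonneg _ _) ?_)
    change 0 ≤ (u p.1 - u p.2) * (w p.1 - w p.2)
    rw [hwx, hwx]
    nlinarith [clamp_sub_mul_sub_clamp_nonneg 0 1 (u p.1) (u p.2),
      sq_nonneg (u p.1 - clamp 0 1 (u p.1) - (u p.2 - clamp 0 1 (u p.2)))]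
  rw [heq, one_smul] at hnn
  have hle : inner ℝ (f - u) w ≤ -inner ℝ w w := by
    have hs : inner ℝ (f - u) w + inner ℝ w w = inner ℝ (f - u + w) w := (inner_add_left ..).symm
    have hneg : inner ℝ (f - u + w) w ≤ 0 := by
      rw [Ell2.inner_eq]
      refine tsum_nonpos fun x => mul_nonpos_of_nonpos_of_nonneg ?_ (m.pos x).le
      simp only [map_add, map_sub, Pi.add_apply, Pi.sub_apply, hwx]
      have k0 := h0 x
      have k1 := h1 x
      simp only [clamp]
      rcases max_cases 0 (min 1 (u x)) with h2 | h2 <;> rcases min_cases 1 (u x) with h3 | h3 <;>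
      rw [h2.1] <;> (try rw [h3.1]) <;> nlinarith
    linarith
  have hw0 : w = 0 := by
    have := real_inner_self_nonneg (x := w)
    exact inner_self_eq_zero.1 (le_antisymm (by linarith) this)
  have hux : u x = clamp 0 1 (u x) := by
    have : w x = 0 := by rw [hw0]; rfl
    rw [hwx] at this
    linarith
  rw [hux]
  exact ⟨le_max_left _ _, max_le zero_le_one (min_le_left _ _)⟩

/-- A Caccioppoli inequality. The function `v = 1 - (L + 1)⁻¹ f` is tested against `e² v`, using
`(a - b) (s² a - t² b) = (s a - t b)² - a b (s - t)²`. -/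
theorem caccioppoli (hc : G.c = 0) (hQ : (G.neumannForm m).IsNonnegClosed) {f : Ell2 m}
    (h0 : ∀ x, 0 ≤ f x) (h1 : ∀ x, f x ≤ 1) {e : V → ℝ} (he : (Function.support e).Finite) (x : V) :
    e x ^ 2 * (1 - (G.neumannForm m).resolvent 1 f x) ^ 2 * m.weight x ≤
      1 / 2 * G.edgeSum e + ∑' y, (1 - f y) * e y ^ 2 * m.weight y := by
  set u := (G.neumannForm m).resolvent 1 f with hu
  have hud := hQ.resolvent_mem one_pos f
  have hmk : ∀ y, 0 ≤ 1 - u y ∧ 1 - u y ≤ 1 := fun y => by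
    have := resolvent_markov hc hQ h0 h1 y
    exact ⟨by linarith, by linarith⟩
  have hφs : (Function.support fun y => e y ^ 2 * (1 - u y)).Finite := he.subset fun y hy => by
    by_contra h
    simp [Function.notMem_support.1 h] at hy
  set φ : Ell2 m := Ell2.mk _ (Ell2.summable_of_finite_support m hφs) with hφ
  have hφx : ∀ y, φ y = e y ^ 2 * (1 - u y) := fun y => rfl
  have hφd : φ ∈ (G.neumannForm m).dom :=
    (mem_neumannForm_dom_iff hc).2 (EdgeSummable.of_finite_support hφs)
  have heq := hQ.form_resolvent one_pos f ⟨φ, hφd⟩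
  rw [one_smul] at heq
  have hle : (G.neumannForm m).form ⟨u, hud⟩ ⟨φ, hφd⟩ ≤ 1 / 2 * G.edgeSum e := by
    rw [neumannForm_apply_of_potential_zero hc]
    refine mul_le_mul_of_nonneg_left ?_ (by norm_num)
    refine Summable.tsum_le_tsum (fun p => mul_le_mul_of_nonneg_left ?_ (G.b_nonneg _ _))
      (G.summable_edge hud.1 hφd.1) (EdgeSummable.of_finite_support he)
    change (u p.1 - u p.2) * (φ p.1 - φ p.2) ≤ _
    rw [hφx, hφx]
    have a1 := hmk p.1
    have a2 := hmk p.2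
    have a3 : (1 - u p.1) * (1 - u p.2) ≤ 1 := mul_le_one₀ a1.2 a2.1 a2.2
    nlinarith [sq_nonneg (e p.1 * (1 - u p.1) - e p.2 * (1 - u p.2)),
      mul_le_mul_of_nonneg_right a3 (sq_nonneg (e p.1 - e p.2))]
  have hS : ∀ {g : V → ℝ}, (∀ y, e y = 0 → g y = 0) → Summable g := fun hg =>
    summable_of_hasFiniteSupport (he.subset fun y hy => fun h => hy (hg y h))
  have s1 : Summable fun y => e y ^ 2 * (1 - u y) ^ 2 * m.weight y := hS fun y h => by simp [h]
  have s2 : Summable fun y => (1 - f y) * e y ^ 2 * m.weight y := hS fun y h => by simp [h]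
  have s3 : Summable fun y => (f y - u y) * φ y * m.weight y :=
    hS fun y h => by simp [hφx, h]
  have hinner : inner ℝ (f - u) φ = ∑' y, (f y - u y) * φ y * m.weight y := rfl
  calc e x ^ 2 * (1 - u x) ^ 2 * m.weight x
      ≤ ∑' y, e y ^ 2 * (1 - u y) ^ 2 * m.weight y :=
        s1.le_tsum x fun y _ => by have := (m.pos y).le; positivity
    _ ≤ ∑' y, ((f y - u y) * φ y * m.weight y + (1 - f y) * e y ^ 2 * m.weight y) := by
        refine s1.tsum_le_tsum (fun y => ?_) (s3.add s2)
        have b1 : 0 ≤ (1 - f y) * (e y ^ 2 * m.weight y) * u y := by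
          have := (m.pos y).le
          have b2 : 0 ≤ 1 - f y := by linarith [h1 y]
          have b3 : 0 ≤ u y := by linarith [(hmk y).2]
          positivity
        rw [hφx]
        nlinarith
    _ = inner ℝ (f - u) φ + ∑' y, (1 - f y) * e y ^ 2 * m.weight y := by
        rw [s3.tsum_add s2, hinner]
    _ ≤ _ := by rw [← heq]; gcongr

theorem isStochasticallyComplete_of_null_sequence (hc : G.c = 0)
    (hQ : (G.neumannForm m).IsNonnegClosed) {e : ℕ → V → ℝ}
    (hsupp : ∀ n, (Function.support (e n)).Finite)
    (hE : Tendsto (fun n => G.edgeSum (e n)) atTop (𝓝 0))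
    (hlim : ∀ x, Tendsto (fun n => e n x) atTop (𝓝 1)) :
    (G.neumannForm m).IsStochasticallyComplete := by
  intro f hf0 hmono hf1 x
  have hfle : ∀ k y, f k y ≤ 1 := fun k y => (hmono y).ge_of_tendsto (hf1 y) k
  have hm := m.pos x
  rw [Metric.tendsto_atTop]
  intro ε hε
  have hη : 0 < ε ^ 2 * m.weight x / 8 := by positivity
  obtain ⟨n, hn1, hn2⟩ := ((hE.eventually_lt_const hη).and
    ((hlim x).eventually_const_lt (show (1 / 2 : ℝ) < 1 by norm_num))).exists
  have hsum : Summable fun y => e n y ^ 2 * m.weight y :=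
    Ell2.summable_of_finite_support m (hsupp n)
  have hlim0 : Tendsto (fun k => ∑' y, (1 - f k y) * e n y ^ 2 * m.weight y) atTop (𝓝 0) := by
    have := tendsto_tsum_of_dominated_convergence (𝓕 := atTop)
      (f := fun k y => (1 - f k y) * e n y ^ 2 * m.weight y) (g := fun _ => 0) hsum
      (fun y => by
        have := (((hf1 y).const_sub 1).mul_const (e n y ^ 2)).mul_const (m.weight y)
        simpa using this)
      (Eventually.of_forall fun k y => by
        have b0 : 0 ≤ e n y ^ 2 * m.weight y := mul_nonneg (sq_nonneg _) (m.pos y).le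
        have b1 : 0 ≤ 1 - f k y := by linarith [hfle k y]
        rw [mul_assoc, Real.norm_of_nonneg (mul_nonneg b1 b0)]
        exact mul_le_of_le_one_left b0 (by linarith [hf0 k y]))
    simpa using this
  obtain ⟨K, hK⟩ := eventually_atTop.1 (hlim0.eventually_lt_const hη)
  refine ⟨K, fun k hk => ?_⟩
  have h1 := caccioppoli hc hQ (hf0 k) (hfle k) (hsupp n) x
  have h2 := hK k hk
  set v := (G.neumannForm m).resolvent 1 (f k) x
  have h3 : (1 / 4 : ℝ) ≤ e n x ^ 2 := by nlinarith
  have h4 : 1 / 4 * ((1 - v) ^ 2 * m.weight x) ≤ e n x ^ 2 * ((1 - v) ^ 2 * m.weight x) :=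
    mul_le_mul_of_nonneg_right h3 (by positivity)
  have h5 : (1 - v) ^ 2 * m.weight x < ε ^ 2 * m.weight x := by nlinarith
  rw [Real.dist_eq, abs_sub_comm]
  exact abs_lt_of_sq_lt_sq (lt_of_mul_lt_mul_right h5 hm.le) hε.le

end WeightedGraph

end

theorem mainTheorem3 {V : Type*} [Countable V] [Infinite V] (G : WeightedGraph V)
    (m : VertexMeasure V) (hc : G.c = 0) (hconn : G.IsConnected)
    (hrec : (G.regularForm m).IsRecurrent) :
    (G.regularForm m).IsStochasticallyComplete ∧ G.regularForm m = G.neumannForm m := by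
  obtain ⟨e, hsupp, h0, h1, hE, hlim⟩ := WeightedGraph.exists_null_sequence hc hconn hrec
  have heq : G.regularForm m = G.neumannForm m :=
    WeightedGraph.regularForm_eq_neumannForm_of_le fun u hu =>
      WeightedGraph.mem_regularDomain_of_clamp hc hu fun v hv M hM =>
        WeightedGraph.mem_regularDomain_of_bounded hc hsupp h0 h1 hE hlim hv hM
  have hQ := WeightedGraph.regularForm_isNonnegClosed (m := m) hc
  rw [heq] at hQ ⊢
  exact ⟨WeightedGraph.isStochasticallyComplete_of_null_sequence hc hQ hsupp hE hlim, rfl⟩
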